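/- **Theorem 2 (OED capacity scaling).** Fix a power $P>0$ and a subcarrier bandwidth $\Delta f>0$. Consider the non-coherent i.i.d. Rayleigh block-fading wideband SIMO channel with $N$ receive antennas, $B$ subcarriers and coherence block length $L$, $$\mathbf Y[b]=\mathbf h[b]\,\mathbf x[b]^H+\mathbf Z[b]\in\mathbb C^{N\times L},\qquad b=0,\dots,B-1,$$ where all entries of all $\mathbf h[b]\in\mathbb C^N$ and $\mathbf Z[b]\in\mathbb C^{N\times L}$ are i.i.d. $\mathcal{CN}(0,1)$, independent of the inputs $\mathbf x[b]\in\mathbb C^L$, unknown to transmitter and receiver, and the inputs satisfy $\mathbb E\big[\tfrac1L\sum_{b}\|\mathbf x[b]\|^2\big]\le P$. The non-coherent capacity is $$C_n(B,N,L)=\sup\ \frac{I(\{\mathbf x[b]\}_b;\{\mathbf Y[b]\}_b)}{L/\Delta f},$$ the supremum being over all joint laws of $\{\mathbf x[b]\}_b$ satisfying the power constraint. An Only Energy Detection (OED) input is one of the form $\mathbf x[b]=\sqrt{a[b]}\,\mathbf u[b]$ with $a[b]\ge 0$ and $\|\mathbf u[b]\|=1$, the energies $\{a[b]\}_b$ being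 independent of the shapes $\{\mathbf u[b]\}_b$ (so $a[b]=\|\mathbf x[b]\|^2$ and only the energies carry information; a constant $\mathbf u[b]$ is energy modulation). The OED capacity is $$C_E(B,N,L)=\sup\ \frac{I(\{a[b]\}_b;\{\mathbf Y[b]\}_b)}{L/\Delta f},$$ the supremum being over all OED inputs satisfying the power constraint. Mutual information is measured in bits. Say that $f(N)$ *scales with exponent* $e$, written $f=\Theta(N^e)$ in the sense of exponents, if $0<f(N)<\infty$ for all large $N$ and $\lim_{N\to\infty}\log f(N)/\log N=e$. Let $\varepsilon,\tau\ge 0$ and let $B=B(N)$ and $L=L(N)$ scale with exponents $\varepsilon$ and $\tau$ respectively. Then $C_E(B,N,L)$ scales with exponent $$\min\left(\varepsilon-\tau,\tfrac12\right).$$ Consequently, if $\tau>0$, no OED scheme attains the scaling of the non-coherent capacity: there is $\delta>0$ such that $N^{\delta}\,C_E(B,N,L)\le C_n(B,N,L)$ for all sufficiently large $N$. -/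

import Mathlib

open MeasureTheory ProbabilityTheory Filter Topology
open scoped ENNReal NNReal

noncomputable section

namespace WidebandSIMO

/-- The circularly symmetric complex Gaussian law `𝒞𝒩(0,1)`: independent real and imaginary
parts, each real Gaussian with mean `0` and variance `1/2`. -/
def stdComplexGaussian : Measure ℂ :=
  ((gaussianReal 0 (1 / 2)).prod (gaussianReal 0 (1 / 2))).map fun p => (⟨p.1, p.2⟩ : ℂ)

/-- Channel inputs: for each of the `B` subcarriers, a vector `x[b] ∈ ℂ^L`. -/
abbrev Input (B L : ℕ) : Type := Fin B → EuclideanSpace ℂ (Fin L)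

/-- Fading coefficients: `h[b] ∈ ℂ^N` for each subcarrier. -/
abbrev Fading (B N : ℕ) : Type := Fin B → Fin N → ℂ

/-- Noise realizations and channel outputs: an `N × L` complex array for each subcarrier. -/
abbrev Output (B N L : ℕ) : Type := Fin B → Fin N → Fin L → ℂ

/-- I.i.d. Rayleigh fading: all coefficients `h_n[b]` are independent `𝒞𝒩(0,1)`. -/
def fadingLaw (B N : ℕ) : Measure (Fading B N) :=
  Measure.pi fun _ => Measure.pi fun _ => stdComplexGaussian

/-- White noise: all coefficients `z_{n,ℓ}[b]` are independent `𝒞𝒩(0,1)`. -/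
def noiseLaw (B N L : ℕ) : Measure (Output B N L) :=
  Measure.pi fun _ => Measure.pi fun _ => Measure.pi fun _ => stdComplexGaussian

/-- The block fading channel `Y[b] = h[b] x[b]ᴴ + Z[b]`. -/
def channelOutput {B N L : ℕ} (x : Input B L) (h : Fading B N) (z : Output B N L) :
    Output B N L :=
  fun b n l => h b n * star (x b l) + z b n l

/-- Average transmitted power `E[(1/L) ∑_b ∑_ℓ |x_ℓ[b]|²]` of an input law. -/
def avgPower {B L : ℕ} (p : Measure (Input B L)) : ℝ≥0∞ :=
  ∫⁻ x, (∑ b, ∑ l, ‖x b l‖ₑ ^ 2) / (L : ℝ≥0∞) ∂p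

/-- Mutual information, in bits, of a pair of random variables with joint law `ρ`: the
Kullback–Leibler divergence of `ρ` from the product of its marginals, divided by `log 2`. -/
def mutualInfo {α β : Type*} [MeasurableSpace α] [MeasurableSpace β]
    (ρ : Measure (α × β)) : ℝ≥0∞ :=
  InformationTheory.klDiv ρ (ρ.fst.prod ρ.snd) / ENNReal.ofReal (Real.log 2)

/-- Admissible inputs of the non-coherent channel: all probability laws of `{x[b]}_b` that
satisfy the average power constraint. -/
structure IsInput {B L : ℕ} (P : ℝ) (p : Measure (Input B L)) : Prop where
  isProbabilityMeasure : IsProbabilityMeasure p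
  power : avgPower p ≤ ENNReal.ofReal P

/-- Joint law of `({x[b]}_b, {Y[b]}_b)`; neither side knows the fading, so it is averaged out. -/
def inputOutputLaw {B L : ℕ} (N : ℕ) (p : Measure (Input B L)) :
    Measure (Input B L × Output B N L) :=
  (p.prod ((fadingLaw B N).prod (noiseLaw B N L))).map
    fun ω => (ω.1, channelOutput ω.1 ω.2.1 ω.2.2)

/-- The non-coherent ergodic capacity `C_n`, in bits per second. -/
def nonCoherentCapacity (P Δf : ℝ) (B N L : ℕ) : ℝ≥0∞ :=
  ⨆ (p : Measure (Input B L)) (_ : IsInput P p),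
    mutualInfo (inputOutputLaw N p) / ((L : ℝ≥0∞) / ENNReal.ofReal Δf)

/-- Energy–shape composition: `x[b] = √a[b] · u[b]`. -/
def energyShape {B L : ℕ} (a : Fin B → ℝ) (u : Input B L) : Input B L :=
  fun b => ((√(a b) : ℝ) : ℂ) • u b

/-- Only-energy-detection (OED) inputs: `x[b] = √a[b] · u[b]` with nonnegative block energies
`{a[b]}_b` of joint law `pa` and unit-norm shapes `{u[b]}_b` of joint law `pu`, the energies
being independent of the shapes (the law of the pair is `pa.prod pu`). Energy modulation is the
case of a constant `u[b]`; the isotropic unit vector is another. -/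
structure IsOEDInput {B L : ℕ} (P : ℝ) (pa : Measure (Fin B → ℝ)) (pu : Measure (Input B L)) :
    Prop where
  isProbabilityMeasure_energy : IsProbabilityMeasure pa
  isProbabilityMeasure_shape : IsProbabilityMeasure pu
  energy_nonneg : ∀ᵐ a ∂pa, ∀ b, 0 ≤ a b
  shape_unit : ∀ᵐ u ∂pu, ∀ b, ‖u b‖ = 1
  power : avgPower ((pa.prod pu).map fun ω => energyShape ω.1 ω.2) ≤ ENNReal.ofReal P

/-- Joint law of `({a[b]}_b, {Y[b]}_b)` for an OED input; shapes and fading are unknown to the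
receiver, so they are averaged out. -/
def energyOutputLaw {B L : ℕ} (N : ℕ) (pa : Measure (Fin B → ℝ)) (pu : Measure (Input B L)) :
    Measure ((Fin B → ℝ) × Output B N L) :=
  ((pa.prod pu).prod ((fadingLaw B N).prod (noiseLaw B N L))).map
    fun ω => (ω.1.1, channelOutput (energyShape ω.1.1 ω.1.2) ω.2.1 ω.2.2)

/-- The OED capacity `C_E`, in bits per second. -/
def oedCapacity (P Δf : ℝ) (B N L : ℕ) : ℝ≥0∞ :=
  ⨆ (pa : Measure (Fin B → ℝ)) (pu : Measure (Input B L)) (_ : IsOEDInput P pa pu),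
    mutualInfo (energyOutputLaw N pa pu) / ((L : ℝ≥0∞) / ENNReal.ofReal Δf)

/-- `f` scales with exponent `e`: for large `N` it is positive and finite, and
`log f(N) / log N → e`. -/
def HasScalingExponent (f : ℕ → ℝ≥0∞) (e : ℝ) : Prop :=
  (∀ᶠ N in atTop, f N ≠ 0 ∧ f N ≠ ∞) ∧
    Tendsto (fun N => Real.log (f N).toReal / Real.log N) atTop (𝓝 e)

end WidebandSIMO

end

/-!
Given the shapes, the output depends on the energies through received energies of the subcarriers,
each a sum over `N` antennas, so an energy is resolved to the accuracy `1 / √N`. Comparing the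
channel with the mixture of channels whose energies are drawn from a heavy-tailed prior on the grid
`ℕ / √N` bounds the information carried by an energy `a` by the cost of quantizing `a` to the grid.
Up to logarithms this cost is at most `√N * a` and at most a constant. The first bound and the power
constraint give the exponent `1 / 2`, the second bound summed over the subcarriers gives `ε - τ`.
Conversely, independent on–off energies of order `1 / √N` are detected by Chebyshev's inequality,
and each contributes a fixed multiple of the variance of its on–off indicator to the information.

For the non-coherent capacity, a pilot of energy `A` makes antipodal symbols of energy of order
`1 / (N * A)` detectable. All `L` symbols of a block share the pilot, and with `A` of order
`√(L / N)` this yields the exponent `min ε ((1 + min τ 1) / 2)`, which exceeds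
`min (ε - τ) (1 / 2)` as soon as `τ > 0`.
-/

noncomputable section

namespace WidebandSIMO

open InformationTheory

/-! ### Divergence and mutual information -/

section Divergence

variable {α β ι : Type*} [MeasurableSpace α] [MeasurableSpace β]

lemma klDiv_prod_marginals_le [StandardBorelSpace α] (ρ : Measure (α × β)) [IsProbabilityMeasure ρ]
    (Q : Measure β) [IsProbabilityMeasure Q] :
    klDiv ρ (ρ.fst.prod ρ.snd) ≤ klDiv ρ (ρ.fst.prod Q) := by
  have : Nonempty α := (nonempty_of_isProbabilityMeasure ρ).map Prod.fst
  set σ := ρ.map Prod.swap with hσ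
  have : IsProbabilityMeasure σ := Measure.isProbabilityMeasure_map measurable_swap.aemeasurable
  have hσfst : σ.fst = ρ.snd := Measure.fst_map_swap
  have hσswap : σ.map Prod.swap = ρ := by
    rw [hσ, Measure.map_map measurable_swap measurable_swap, Prod.swap_swap_eq, Measure.map_id]
  have hσmarg : klDiv ρ (ρ.fst.prod ρ.snd) ≤ klDiv σ (ρ.snd.prod ρ.fst) := by
    have := klDiv_map_le σ (ρ.snd.prod ρ.fst) (g := Prod.swap) measurable_swap
    rwa [hσswap, Measure.prod_swap] at this
  have hσQ : klDiv σ (Q.prod ρ.fst) ≤ klDiv ρ (ρ.fst.prod Q) := by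
    have := klDiv_map_le ρ (ρ.fst.prod Q) (g := Prod.swap) measurable_swap
    rwa [← hσ, Measure.prod_swap] at this
  have hdis : ρ.snd ⊗ₘ σ.condKernel = σ := by
    rw [← hσfst]
    exact σ.disintegrate σ.condKernel
  have hchain := klDiv_compProd_eq_add ρ.snd Q σ.condKernel (Kernel.const β ρ.fst)
  rw [hdis, Measure.compProd_const, Measure.compProd_const] at hchain
  calc klDiv ρ (ρ.fst.prod ρ.snd) ≤ klDiv σ (ρ.snd.prod ρ.fst) := hσmarg
    _ ≤ klDiv ρ.snd Q + klDiv σ (ρ.snd.prod ρ.fst) := le_add_self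
    _ = klDiv σ (Q.prod ρ.fst) := hchain.symm
    _ ≤ klDiv ρ (ρ.fst.prod Q) := hσQ

lemma klFun_le_of_le_exp {r t : ℝ} (hr : 0 ≤ r) (hrt : r ≤ Real.exp t) :
    klFun r ≤ r * t - r + 1 := by
  have : r * Real.log r ≤ r * t := by
    rcases hr.eq_or_lt with rfl | hpos
    · simp
    · exact mul_le_mul_of_nonneg_left ((Real.log_le_iff_le_exp hpos).2 hrt) hr
  rw [klFun_apply]
  linarith

lemma klDiv_le_of_le_withDensity_exp (μ ν : Measure α) [IsProbabilityMeasure μ]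
    [IsProbabilityMeasure ν] {g : α → ℝ} (hg : Integrable g μ)
    (hle : μ ≤ ν.withDensity fun x => ENNReal.ofReal (Real.exp (g x))) :
    klDiv μ ν ≤ ENNReal.ofReal (∫ x, g x ∂μ) := by
  have hac : μ ≪ ν := (Measure.absolutelyContinuous_of_le hle).trans
    (withDensity_absolutelyContinuous _ _)
  set r : α → ℝ := fun x => (μ.rnDeriv ν x).toReal
  have hdens : μ.rnDeriv ν ≤ᵐ[ν] fun x => ENNReal.ofReal (Real.exp (g x)) := by
    refine ae_le_of_forall_setLIntegral_le_of_sigmaFinite (Measure.measurable_rnDeriv _ _) ?_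
    intro s hs _
    rw [Measure.setLIntegral_rnDeriv hac, ← withDensity_apply _ hs]
    exact hle s
  have hkl : ∀ᵐ x ∂ν, klFun (r x) ≤ r x * g x - r x + 1 := by
    filter_upwards [hdens] with x hx
    exact klFun_le_of_le_exp ENNReal.toReal_nonneg
      (ENNReal.toReal_le_of_le_ofReal (Real.exp_pos _).le hx)
  have hr : Integrable r ν := Measure.integrable_toReal_rnDeriv
  have hrg : Integrable (fun x => r x * g x) ν := by
    simpa only [smul_eq_mul] using (integrable_rnDeriv_smul_iff (f := g) hac).2 hg
  have hsub : Integrable (fun x => r x * g x - r x) ν := hrg.sub hr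
  have hbound : Integrable (fun x => r x * g x - r x + 1) ν := hsub.add (integrable_const _)
  have hint : ∫ x, (r x * g x - r x + 1) ∂ν = ∫ x, g x ∂μ := by
    have hchange : ∫ x, r x * g x ∂ν = ∫ x, g x ∂μ := by
      simpa only [smul_eq_mul] using integral_rnDeriv_smul (f := g) hac
    rw [integral_add hsub (integrable_const _), integral_sub hrg hr, hchange,
      Measure.integral_toReal_rnDeriv hac]
    simp
  rw [klDiv_eq_lintegral_klFun_of_ac hac, ← hint, ofReal_integral_eq_lintegral_ofReal hbound]
  · exact lintegral_mono_ae (hkl.mono fun x hx => ENNReal.ofReal_le_ofReal hx)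
  · filter_upwards [hkl] with x hx
    exact (klFun_nonneg ENNReal.toReal_nonneg).trans hx

/-- The Donsker–Varadhan variational bound. -/
lemma ofReal_integral_sub_log_integral_exp_le_klDiv (μ ν : Measure α) [IsProbabilityMeasure μ]
    [IsProbabilityMeasure ν] {g : α → ℝ} (hgμ : Integrable g μ)
    (hgν : Integrable (fun x => Real.exp (g x)) ν) :
    ENNReal.ofReal (∫ x, g x ∂μ - Real.log (∫ x, Real.exp (g x) ∂ν)) ≤ klDiv μ ν := by
  by_cases hfin : klDiv μ ν = ∞
  · simp [hfin]
  obtain ⟨hac, hllr⟩ := klDiv_ne_top_iff.1 hfin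
  have := isProbabilityMeasure_tilted hgν
  have h := integral_llr_add_sub_measure_univ_nonneg (hac.trans (absolutelyContinuous_tilted hgν))
    (integrable_llr_tilted_right hac hgμ hllr hgν)
  rw [integral_llr_tilted_right hac hgμ hgν hllr] at h
  rw [klDiv_of_ac_of_integrable hac hllr]
  refine ENNReal.ofReal_le_ofReal ?_
  simp only [probReal_univ] at h ⊢
  linarith

lemma integral_exp_mul_le_of_variance_le (μ : Measure α) [IsProbabilityMeasure μ] {ψ : α → ℝ}
    (hψ : Measurable ψ) (hb : ∀ x, |ψ x| ≤ 1) (h0 : ∫ x, ψ x ∂μ = 0) {v : ℝ}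
    (hv : ∫ x, ψ x ^ 2 ∂μ ≤ v) {c : ℝ} (hc : |c| ≤ 1) :
    ∫ x, Real.exp (c * ψ x) ∂μ ≤ Real.exp (v * c ^ 2) := by
  have hi : Integrable ψ μ := Integrable.of_bound hψ.aestronglyMeasurable 1 (ae_of_all _ hb)
  have hi2 : Integrable (fun x => ψ x ^ 2) μ := by
    refine Integrable.of_bound (hψ.pow_const 2).aestronglyMeasurable 1 (ae_of_all _ fun x => ?_)
    rw [Real.norm_eq_abs, abs_pow]
    exact pow_le_one₀ (abs_nonneg _) (hb x)
  have hlin : Integrable (fun x => 1 + c * ψ x) μ := (integrable_const _).add (hi.const_mul c)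
  have hpt (x : α) : Real.exp (c * ψ x) ≤ 1 + c * ψ x + c ^ 2 * ψ x ^ 2 := by
    have hx : |c * ψ x| ≤ 1 := by
      rw [abs_mul]
      exact mul_le_one₀ hc (abs_nonneg _) (hb x)
    linarith [(abs_le.1 (Real.abs_exp_sub_one_sub_id_le hx)).2, mul_pow c (ψ x) 2]
  calc ∫ x, Real.exp (c * ψ x) ∂μ ≤ ∫ x, (1 + c * ψ x + c ^ 2 * ψ x ^ 2) ∂μ :=
        integral_mono_of_nonneg (ae_of_all _ fun x => (Real.exp_pos _).le)
          (hlin.add (hi2.const_mul _)) (ae_of_all _ hpt)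
    _ = 1 + c ^ 2 * ∫ x, ψ x ^ 2 ∂μ := by
        rw [integral_add hlin (hi2.const_mul _),
          integral_add (integrable_const _) (hi.const_mul c), integral_const_mul,
          integral_const_mul, h0]
        simp
    _ ≤ v * c ^ 2 + 1 := by nlinarith [sq_nonneg c]
    _ ≤ Real.exp (v * c ^ 2) := Real.add_one_le_exp _

lemma integral_prod_le_of_forall_integral_le (μ : Measure α) (ν : Measure β)
    [IsProbabilityMeasure μ] [IsProbabilityMeasure ν] {f : α × β → ℝ}
    (hf : Integrable f (μ.prod ν)) {C : ℝ} (hC : ∀ y, ∫ x, f (x, y) ∂μ ≤ C) :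
    ∫ z, f z ∂μ.prod ν ≤ C := by
  rw [integral_prod_symm _ hf]
  calc ∫ y, ∫ x, f (x, y) ∂μ ∂ν ≤ ∫ _, C ∂ν :=
        integral_mono hf.integral_prod_right (integrable_const _) hC
    _ = C := by simp

lemma integral_indicator_sub_const_sq (μ : Measure α) [IsProbabilityMeasure μ] {A : Set α}
    (hA : MeasurableSet A) (p : ℝ) :
    ∫ x, (A.indicator 1 x - p) ^ 2 ∂μ = (1 - 2 * p) * μ.real A + p ^ 2 := by
  have hsq (x : α) : (A.indicator 1 x - p) ^ 2 = (1 - 2 * p) * A.indicator 1 x + p ^ 2 := by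
    by_cases hx : x ∈ A <;> simp only [hx, Set.indicator_of_mem, Set.indicator_of_notMem,
      not_false_eq_true, Pi.one_apply] <;> ring
  simp only [hsq]
  rw [integral_add (((integrable_const _).indicator hA).const_mul _) (integrable_const _),
    integral_const_mul, integral_indicator_one hA]
  simp

lemma integral_indicator_sub_const_mul_indicator (ρ : Measure (α × β)) [IsFiniteMeasure ρ]
    {A : Set α} {S : Set β} (hA : MeasurableSet A) (hS : MeasurableSet S) (p : ℝ) :
    ∫ z, (A.indicator 1 z.1 - p) * S.indicator 1 z.2 ∂ρ =
      (1 - p) * ρ.real (A ×ˢ S) - p * ρ.real (Aᶜ ×ˢ S) := by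
  have hAS := hA.prod hS
  have hAcS := hA.compl.prod hS
  have hsplit (z : α × β) : (A.indicator 1 z.1 - p) * S.indicator 1 z.2 =
      (1 - p) * (A ×ˢ S).indicator 1 z - p * (Aᶜ ×ˢ S).indicator 1 z := by
    by_cases hx : z.1 ∈ A <;> by_cases hy : z.2 ∈ S <;> simp [hx, hy]
  simp only [hsplit]
  rw [integral_sub (((integrable_const _).indicator hAS).const_mul _)
    (((integrable_const _).indicator hAcS).const_mul _), integral_const_mul, integral_const_mul,
    integral_indicator_one hAS, integral_indicator_one hAcS]

variable [Fintype ι]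

lemma integral_exp_sum_mul_le_of_iIndepFun (μ : Measure α) {ψ : ι → α → ℝ}
    (hψ : ∀ i, Measurable (ψ i)) (hb : ∀ i x, |ψ i x| ≤ 1) (hind : iIndepFun ψ μ)
    (h0 : ∀ i, ∫ x, ψ i x ∂μ = 0) {v : ℝ} (hv0 : 0 ≤ v) (hv : ∀ i, ∫ x, ψ i x ^ 2 ∂μ ≤ v)
    {c : ι → ℝ} {t : ℝ} (ht : t ≤ 1) (hc : ∀ i, |c i| ≤ t) :
    ∫ x, Real.exp (∑ i, c i * ψ i x) ∂μ ≤ Real.exp (Fintype.card ι * (v * t ^ 2)) := by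
  have := hind.isProbabilityMeasure
  simp only [Real.exp_sum]
  rw [hind.integral_fun_prod_comp (f := fun i y => Real.exp (c i * y))
    (fun i => (hψ i).aemeasurable) fun i => by fun_prop]
  calc ∏ i, ∫ x, Real.exp (c i * ψ i x) ∂μ ≤ ∏ _i : ι, Real.exp (v * t ^ 2) := by
        refine Finset.prod_le_prod (fun i _ => integral_nonneg fun _ => (Real.exp_pos _).le)
          fun i _ => ?_
        refine (integral_exp_mul_le_of_variance_le μ (hψ i) (hb i) (h0 i) (hv i)
          ((hc i).trans ht)).trans (Real.exp_le_exp.2 (mul_le_mul_of_nonneg_left ?_ hv0))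
        exact sq_le_sq.2 ((hc i).trans (le_abs_self t))
    _ = Real.exp (Fintype.card ι * (v * t ^ 2)) := by
        rw [Finset.prod_const, Finset.card_univ, Real.exp_nat_mul]

lemma abs_sum_mul_le_card {c x : ι → ℝ} (hc : ∀ i, |c i| ≤ 1) (hx : ∀ i, |x i| ≤ 1) :
    |∑ i, c i * x i| ≤ Fintype.card ι := by
  calc |∑ i, c i * x i| ≤ ∑ i, |c i * x i| := Finset.abs_sum_le_sum_abs _ _
    _ ≤ ∑ _i : ι, (1 : ℝ) := Finset.sum_le_sum fun i _ => by
        rw [abs_mul]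
        exact mul_le_one₀ (hc i) (abs_nonneg _) (hx i)
    _ = Fintype.card ι := by simp

lemma card_mul_le_integral_sum_mul_mul (ρ : Measure (α × β)) [IsFiniteMeasure ρ]
    {ψ : ι → α → ℝ} {φ : ι → β → ℝ} (hψ : ∀ i, Measurable (ψ i)) (hφ : ∀ i, Measurable (φ i))
    (hψb : ∀ i x, |ψ i x| ≤ 1) (hφb : ∀ i y, |φ i y| ≤ 1) {t κ : ℝ} (ht : 0 ≤ t)
    (hcorr : ∀ i, κ ≤ ∫ z, ψ i z.1 * φ i z.2 ∂ρ) :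
    Fintype.card ι * (t * κ) ≤ ∫ z, ∑ i, (t * φ i z.2) * ψ i z.1 ∂ρ := by
  have hint (i : ι) : Integrable (fun z : α × β => φ i z.2 * ψ i z.1) ρ := by
    refine .of_bound (by fun_prop) 1 (ae_of_all _ fun z => ?_)
    rw [norm_mul]
    exact mul_le_one₀ (hφb i _) (norm_nonneg _) (hψb i _)
  simp only [mul_assoc t]
  rw [integral_finsetSum _ fun i _ => (hint i).const_mul t, ← nsmul_eq_mul, ← Finset.card_univ]
  refine Finset.card_nsmul_le_sum _ _ _ fun i _ => ?_
  simp only [integral_const_mul, mul_comm (φ i _)]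
  exact mul_le_mul_of_nonneg_left (hcorr i) ht

/-- Donsker–Varadhan with the test function `∑ i, (Δ / 2) * φ i y * ψ i x`. -/
lemma card_mul_le_klDiv_of_iIndepFun (ρ : Measure (α × β)) [IsProbabilityMeasure ρ]
    {ψ : ι → α → ℝ} {φ : ι → β → ℝ} (hψ : ∀ i, Measurable (ψ i)) (hφ : ∀ i, Measurable (φ i))
    (hψb : ∀ i x, |ψ i x| ≤ 1) (hφb : ∀ i y, |φ i y| ≤ 1) (hind : iIndepFun ψ ρ.fst)
    (h0 : ∀ i, ∫ x, ψ i x ∂ρ.fst = 0) {v Δ : ℝ} (hv0 : 0 ≤ v)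
    (hv : ∀ i, ∫ x, ψ i x ^ 2 ∂ρ.fst ≤ v) (hΔ : 0 ≤ Δ) (hΔ2 : Δ ≤ 2)
    (hcorr : ∀ i, Δ * v ≤ ∫ z, ψ i z.1 * φ i z.2 ∂ρ) :
    ENNReal.ofReal (Fintype.card ι * (v * Δ ^ 2 / 4)) ≤ klDiv ρ (ρ.fst.prod ρ.snd) := by
  set t := Δ / 2 with ht
  have ht0 : 0 ≤ t := by positivity
  have ht1 : t ≤ 1 := by linarith
  let g : α × β → ℝ := fun z => ∑ i, (t * φ i z.2) * ψ i z.1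
  have hgm : Measurable g := by fun_prop
  have htφ (i : ι) (y : β) : |t * φ i y| ≤ t := by
    rw [abs_mul, abs_of_nonneg ht0]
    exact mul_le_of_le_one_right ht0 (hφb i y)
  have hgb (z : α × β) : |g z| ≤ Fintype.card ι :=
    abs_sum_mul_le_card (fun i => (htφ i z.2).trans ht1) fun i => hψb i z.1
  have hgi : Integrable g ρ := .of_bound hgm.aestronglyMeasurable _ (ae_of_all _ hgb)
  have hgei : Integrable (fun z => Real.exp (g z)) (ρ.fst.prod ρ.snd) := by
    refine .of_bound (by fun_prop) (Real.exp (Fintype.card ι)) (ae_of_all _ fun z => ?_)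
    rw [Real.norm_eq_abs, Real.abs_exp]
    exact Real.exp_le_exp.2 ((le_abs_self _).trans (hgb z))
  refine le_trans (ENNReal.ofReal_le_ofReal ?_)
    (ofReal_integral_sub_log_integral_exp_le_klDiv ρ (ρ.fst.prod ρ.snd) hgi hgei)
  have hmean : Fintype.card ι * (t * (Δ * v)) ≤ ∫ z, g z ∂ρ :=
    card_mul_le_integral_sum_mul_mul ρ hψ hφ hψb hφb ht0 hcorr
  have hlog : Real.log (∫ z, Real.exp (g z) ∂ρ.fst.prod ρ.snd) ≤
      Fintype.card ι * (v * t ^ 2) :=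
    (Real.log_le_iff_le_exp (integral_exp_pos hgei)).2
      (integral_prod_le_of_forall_integral_le _ _ hgei fun y =>
        integral_exp_sum_mul_le_of_iIndepFun _ hψ hψb hind h0 hv0 hv ht1 fun i => htφ i y)
  have hconst : (Fintype.card ι : ℝ) * (v * Δ ^ 2 / 4) =
      Fintype.card ι * (t * (Δ * v)) - Fintype.card ι * (v * t ^ 2) := by
    rw [ht]
    ring
  linarith

lemma card_mul_le_klDiv_of_iIndepSet (ρ : Measure (α × β)) [IsProbabilityMeasure ρ]
    {A : ι → Set α} {S : ι → Set β} (hA : ∀ i, MeasurableSet (A i)) (hS : ∀ i, MeasurableSet (S i))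
    (hind : iIndepSet A ρ.fst) {p d₀ d₁ : ℝ} (hp : ∀ i, ρ.fst.real (A i) = p)
    (hp0 : 0 ≤ p) (hp1 : p ≤ 1) (hd : d₀ ≤ d₁) (hd2 : d₁ ≤ d₀ + 2)
    (hhit : ∀ i, d₁ * p ≤ ρ.real (A i ×ˢ S i))
    (hmiss : ∀ i, ρ.real ((A i)ᶜ ×ˢ S i) ≤ d₀ * (1 - p)) :
    ENNReal.ofReal (Fintype.card ι * (p * (1 - p) * (d₁ - d₀) ^ 2 / 4)) ≤
      klDiv ρ (ρ.fst.prod ρ.snd) := by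
  have hq : 0 ≤ 1 - p := by linarith
  refine card_mul_le_klDiv_of_iIndepFun ρ (ψ := fun i x => (A i).indicator 1 x - p)
    (φ := fun i => (S i).indicator 1) (fun i => ?_) (fun i => ?_) (fun i x => ?_) (fun i y => ?_)
    ?_ (fun i => ?_) (mul_nonneg hp0 hq) (fun i => ?_) (sub_nonneg.2 hd) (by linarith) fun i => ?_
  · exact (measurable_one.indicator (hA i)).sub_const p
  · exact measurable_one.indicator (hS i)
  · rw [abs_le]
    by_cases hx : x ∈ A i <;> simp only [hx, Set.indicator_of_mem, Set.indicator_of_notMem,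
      not_false_eq_true, Pi.one_apply] <;> constructor <;> linarith
  · by_cases hy : y ∈ S i <;> simp [hy]
  · exact (hind.iIndepFun_indicator (β := ℝ)).comp (fun _ y => y - p) fun _ => by fun_prop
  · rw [integral_sub ((integrable_const _).indicator (hA i)) (integrable_const _),
      integral_indicator_one (hA i), hp]
    simp
  · rw [integral_indicator_sub_const_sq _ (hA i), hp]
    linarith [sq p]
  · rw [integral_indicator_sub_const_mul_indicator ρ (hA i) (hS i)]
    nlinarith [hhit i, hmiss i]

end Divergence

/-! ### Product densities -/

section Pi

variable {ι : Type*} [Fintype ι] {Ω : ι → Type*} [∀ i, MeasurableSpace (Ω i)]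
  (μ : ∀ i, Measure (Ω i)) [∀ i, IsProbabilityMeasure (μ i)] {f : ∀ i, Ω i → ℝ≥0∞}

lemma lintegral_pi_prod (hf : ∀ i, Measurable (f i)) :
    ∫⁻ x, ∏ i, f i (x i) ∂Measure.pi μ = ∏ i, ∫⁻ x, f i x ∂μ i := by
  have hind : iIndepFun (fun i (ω : ∀ i, Ω i) => f i (ω i)) (Measure.pi μ) :=
    iIndepFun_pi fun i => (hf i).aemeasurable
  rw [lintegral_prod_eq_prod_lintegral_of_indepFun Finset.univ _ hind
    fun i => (hf i).comp (measurable_pi_apply i)]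
  exact Finset.prod_congr rfl fun i _ => (measurePreserving_eval μ i).lintegral_comp (hf i)

lemma pi_withDensity (hf : ∀ i, Measurable (f i)) [∀ i, SigmaFinite ((μ i).withDensity (f i))] :
    Measure.pi (fun i => (μ i).withDensity (f i)) =
      (Measure.pi μ).withDensity fun x => ∏ i, f i (x i) := by
  classical
  refine Measure.pi_eq fun s hs => ?_
  have hind (x : ∀ i, Ω i) : (Set.univ.pi s).indicator (fun x => ∏ i, f i (x i)) x =
      ∏ i, (s i).indicator (f i) (x i) := by
    by_cases hx : x ∈ Set.univ.pi s
    · rw [Set.indicator_of_mem hx]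
      exact Finset.prod_congr rfl fun i _ => (Set.indicator_of_mem (hx i (Set.mem_univ i)) _).symm
    · obtain ⟨i, hi⟩ : ∃ i, x i ∉ s i := by simpa only [Set.mem_univ_pi, not_forall] using hx
      rw [Set.indicator_of_notMem hx,
        Finset.prod_eq_zero (Finset.mem_univ i) (Set.indicator_of_notMem hi _)]
  simp_rw [withDensity_apply _ (MeasurableSet.univ_pi hs), withDensity_apply _ (hs _),
    ← lintegral_indicator (MeasurableSet.univ_pi hs), ← lintegral_indicator (hs _), hind]
  exact lintegral_pi_prod μ fun i => (hf i).indicator (hs i)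

lemma pi_map_eq_withDensity {T : ∀ i, Ω i → Ω i} (hT : ∀ i, Measurable (T i))
    (hf : ∀ i, Measurable (f i)) (h : ∀ i, (μ i).map (T i) = (μ i).withDensity (f i)) :
    (Measure.pi μ).map (fun x i => T i (x i)) =
      (Measure.pi μ).withDensity fun x => ∏ i, f i (x i) := by
  have : ∀ i, IsProbabilityMeasure ((μ i).map (T i)) :=
    fun i => Measure.isProbabilityMeasure_map (hT i).aemeasurable
  have : ∀ i, SigmaFinite ((μ i).withDensity (f i)) := fun i => h i ▸ inferInstance
  rw [← pi_withDensity μ hf, Measure.pi_map_pi fun i => (hT i).aemeasurable]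
  simp_rw [h]

end Pi

lemma map_withDensity_comp {α β : Type*} [MeasurableSpace α] [MeasurableSpace β] (μ : Measure α)
    {f : α → β} (hf : Measurable f) {g : β → ℝ≥0∞} (hg : Measurable g) :
    (μ.withDensity (g ∘ f)).map f = (μ.map f).withDensity g := by
  ext s hs
  rw [Measure.map_apply hf hs, withDensity_apply _ (hf hs), withDensity_apply _ hs,
    setLIntegral_map hs hg hf]
  rfl

/-! ### The complex Gaussian law -/

lemma ofReal_exp_add (a b : ℝ) : ENNReal.ofReal (Real.exp (a + b)) =
    ENNReal.ofReal (Real.exp a) * ENNReal.ofReal (Real.exp b) := by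
  rw [Real.exp_add, ENNReal.ofReal_mul (Real.exp_pos _).le]

lemma gaussianReal_map_const_add_eq_withDensity {v : ℝ≥0} (hv : v ≠ 0) (c : ℝ) :
    (gaussianReal 0 v).map (c + ·) = (gaussianReal 0 v).withDensity fun x =>
      ENNReal.ofReal (Real.exp ((2 * c * x - c ^ 2) / (2 * v))) := by
  rw [gaussianReal_map_const_add, gaussianReal_of_var_ne_zero _ hv,
    gaussianReal_of_var_ne_zero _ hv,
    ← withDensity_mul _ (measurable_gaussianPDF _ _) (by fun_prop)]
  congr 1
  ext x
  rw [Pi.mul_apply, gaussianPDF, gaussianPDF, ← ENNReal.ofReal_mul (gaussianPDFReal_nonneg _ _ _),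
    gaussianPDFReal, gaussianPDFReal, mul_assoc (√_)⁻¹, ← Real.exp_add]
  congr 3
  ring

lemma gaussianPDFReal_mul_exp_quadratic {v : ℝ≥0} (hv : v ≠ 0) {s : ℝ≥0} (t x : ℝ) :
    gaussianPDFReal 0 v x * Real.exp (t * x - s * x ^ 2) =
      (√(1 + 2 * s * v))⁻¹ * Real.exp (v * t ^ 2 / (2 * (1 + 2 * s * v))) *
        gaussianPDFReal (v * t / (1 + 2 * s * v)) (v / (1 + 2 * s * v)) x := by
  have : (v : ℝ) ≠ 0 := NNReal.coe_ne_zero.2 hv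
  have hw : (0 : ℝ) < 1 + 2 * s * v := by positivity
  set w : ℝ := 1 + 2 * s * v with hwdef
  have hcoe : ((v / (1 + 2 * s * v) : ℝ≥0) : ℝ) = v / w := by push_cast; rfl
  have hsqrt : (√(2 * Real.pi * v))⁻¹ = (√w)⁻¹ * (√(2 * Real.pi * (v / w)))⁻¹ := by
    rw [← mul_inv, ← Real.sqrt_mul hw.le]
    congr 2
    field_simp
  have hexp : -(x - 0) ^ 2 / (2 * v) + (t * x - s * x ^ 2) =
      v * t ^ 2 / (2 * w) + -(x - v * t / w) ^ 2 / (2 * (v / w)) := by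
    have hs : (s : ℝ) = (w - 1) / (2 * v) := by rw [hwdef]; field_simp; ring
    rw [hs]
    field_simp
    ring
  rw [gaussianPDFReal, gaussianPDFReal, hcoe, mul_assoc, ← Real.exp_add, hexp, Real.exp_add, hsqrt]
  ring

lemma lintegral_exp_quadratic_gaussianReal {v : ℝ≥0} (hv : v ≠ 0) (s : ℝ≥0) (t : ℝ) :
    ∫⁻ x, ENNReal.ofReal (Real.exp (t * x - s * x ^ 2)) ∂gaussianReal 0 v =
      ENNReal.ofReal ((√(1 + 2 * s * v))⁻¹ * Real.exp (v * t ^ 2 / (2 * (1 + 2 * s * v)))) := by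
  rw [gaussianReal_of_var_ne_zero _ hv,
    lintegral_withDensity_eq_lintegral_mul _ (measurable_gaussianPDF _ _) (by fun_prop)]
  simp_rw [Pi.mul_apply, gaussianPDF, ← ENNReal.ofReal_mul (gaussianPDFReal_nonneg _ _ _),
    gaussianPDFReal_mul_exp_quadratic hv]
  have hw : v / (1 + 2 * s * v) ≠ 0 := div_ne_zero hv (by positivity)
  simp_rw [ENNReal.ofReal_mul (show 0 ≤ (√(1 + 2 * s * v : ℝ))⁻¹ *
    Real.exp (v * t ^ 2 / (2 * (1 + 2 * s * v))) by positivity)]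
  rw [lintegral_const_mul _ (by fun_prop), lintegral_gaussianPDFReal_eq_one _ hw, mul_one]

lemma measurable_complex_mk : Measurable fun p : ℝ × ℝ => (⟨p.1, p.2⟩ : ℂ) :=
  Complex.measurableEquivRealProd.symm.measurable

instance : IsProbabilityMeasure stdComplexGaussian :=
  Measure.isProbabilityMeasure_map measurable_complex_mk.aemeasurable

lemma stdComplexGaussian_map_add (c : ℂ) :
    stdComplexGaussian.map (fun z => c + z) = stdComplexGaussian.withDensity fun z =>
      ENNReal.ofReal (Real.exp (2 * (star c * z).re - ‖c‖ ^ 2)) := by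
  have hcomm : (fun z => c + z) ∘ (fun p : ℝ × ℝ => (⟨p.1, p.2⟩ : ℂ)) =
      (fun p : ℝ × ℝ => (⟨p.1, p.2⟩ : ℂ)) ∘ Prod.map (c.re + ·) (c.im + ·) := rfl
  have hhalf : (1 / 2 : ℝ≥0) ≠ 0 := by norm_num
  rw [stdComplexGaussian, Measure.map_map (by fun_prop) measurable_complex_mk, hcomm,
    ← Measure.map_map measurable_complex_mk (by fun_prop),
    ← Measure.map_prod_map _ _ (by fun_prop) (by fun_prop),
    gaussianReal_map_const_add_eq_withDensity hhalf,
    gaussianReal_map_const_add_eq_withDensity hhalf,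
    prod_withDensity (by fun_prop) (by fun_prop),
    ← map_withDensity_comp _ measurable_complex_mk (by fun_prop)]
  congr 2
  ext p
  rw [Function.comp_apply, ← ofReal_exp_add, ← Complex.normSq_eq_norm_sq, Complex.normSq_apply]
  congr 2
  simp only [Complex.mul_re, Complex.star_def, Complex.conj_re, Complex.conj_im]
  push_cast
  ring

lemma lintegral_exp_quadratic_stdComplexGaussian (s : ℝ≥0) (w : ℂ) :
    ∫⁻ h, ENNReal.ofReal (Real.exp (2 * (star h * w).re - s * ‖h‖ ^ 2)) ∂stdComplexGaussian =
      ENNReal.ofReal ((1 + s : ℝ)⁻¹ * Real.exp (‖w‖ ^ 2 / (1 + s))) := by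
  have hsplit (p : ℝ × ℝ) : ENNReal.ofReal (Real.exp (2 * (star (⟨p.1, p.2⟩ : ℂ) * w).re
      - s * ‖(⟨p.1, p.2⟩ : ℂ)‖ ^ 2)) =
      ENNReal.ofReal (Real.exp (2 * w.re * p.1 - s * p.1 ^ 2)) *
        ENNReal.ofReal (Real.exp (2 * w.im * p.2 - s * p.2 ^ 2)) := by
    rw [← ofReal_exp_add, ← Complex.normSq_eq_norm_sq, Complex.normSq_apply]
    congr 2
    simp only [Complex.mul_re, Complex.star_def, Complex.conj_re, Complex.conj_im]
    ring
  have hhalf : (1 / 2 : ℝ≥0) ≠ 0 := by norm_num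
  have hsq : (1 + s : ℝ)⁻¹ = (√(1 + s))⁻¹ * (√(1 + s))⁻¹ := by
    rw [← mul_inv, Real.mul_self_sqrt (by positivity)]
  rw [stdComplexGaussian, lintegral_map (by fun_prop) measurable_complex_mk]
  simp_rw [hsplit]
  rw [lintegral_prod_mul (f := fun x => ENNReal.ofReal (Real.exp (2 * w.re * x - s * x ^ 2)))
      (g := fun y => ENNReal.ofReal (Real.exp (2 * w.im * y - s * y ^ 2)))
      (by fun_prop) (by fun_prop), lintegral_exp_quadratic_gaussianReal hhalf,
    lintegral_exp_quadratic_gaussianReal hhalf, ← ENNReal.ofReal_mul (by positivity),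
    ← Complex.normSq_eq_norm_sq, Complex.normSq_apply, hsq, add_div, Real.exp_add]
  have hvar : 2 * (s : ℝ) * ((1 / 2 : ℝ≥0) : ℝ) = s := by push_cast; ring
  have harg (t : ℝ) : ((1 / 2 : ℝ≥0) : ℝ) * (2 * t) ^ 2 / (2 * (1 + s)) = t * t / (1 + s) := by
    push_cast; field_simp
  rw [hvar, harg, harg]
  congr 1
  ring

lemma measurePreserving_re :
    MeasurePreserving Complex.re stdComplexGaussian (gaussianReal 0 (1 / 2)) := by
  refine ⟨Complex.measurable_re, ?_⟩
  rw [stdComplexGaussian, Measure.map_map Complex.measurable_re measurable_complex_mk]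
  exact (measurePreserving_fst (μ := gaussianReal 0 (1 / 2)) (ν := gaussianReal 0 (1 / 2))).map_eq

lemma measurePreserving_im :
    MeasurePreserving Complex.im stdComplexGaussian (gaussianReal 0 (1 / 2)) := by
  refine ⟨Complex.measurable_im, ?_⟩
  rw [stdComplexGaussian, Measure.map_map Complex.measurable_im measurable_complex_mk]
  exact (measurePreserving_snd (μ := gaussianReal 0 (1 / 2)) (ν := gaussianReal 0 (1 / 2))).map_eq

lemma memLp_stdComplexGaussian (p : ℝ≥0) : MemLp (fun z : ℂ => z) p stdComplexGaussian := by
  have hre : MemLp Complex.re p stdComplexGaussian :=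
    (memLp_id_gaussianReal p).comp_measurePreserving measurePreserving_re
  have him : MemLp Complex.im p stdComplexGaussian :=
    (memLp_id_gaussianReal p).comp_measurePreserving measurePreserving_im
  exact (hre.norm.add him.norm).mono' measurable_id.aestronglyMeasurable
    (ae_of_all _ Complex.norm_le_abs_re_add_abs_im)

lemma integral_stdComplexGaussian : ∫ z, z ∂stdComplexGaussian = 0 := by
  have hint : Integrable (fun z : ℂ => z) stdComplexGaussian :=
    (memLp_stdComplexGaussian 1).integrable le_rfl
  have hre : ∫ z, z.re ∂stdComplexGaussian = 0 := by
    rw [← integral_id_gaussianReal (μ := 0) (v := 1 / 2), ← measurePreserving_re.map_eq,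
      integral_map (by fun_prop) (by fun_prop)]
  have him : ∫ z, z.im ∂stdComplexGaussian = 0 := by
    rw [← integral_id_gaussianReal (μ := 0) (v := 1 / 2), ← measurePreserving_im.map_eq,
      integral_map (by fun_prop) (by fun_prop)]
  exact Complex.ext ((integral_re hint).symm.trans hre) ((integral_im hint).symm.trans him)

lemma integral_sq_gaussianReal (v : ℝ≥0) : ∫ x, x ^ 2 ∂gaussianReal 0 v = v := by
  rw [← variance_fun_id_gaussianReal (μ := 0) (v := v),
    variance_of_integral_eq_zero aemeasurable_id' integral_id_gaussianReal]

lemma integral_norm_sq_stdComplexGaussian : ∫ z, ‖z‖ ^ 2 ∂stdComplexGaussian = 1 := by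
  have hsq : Integrable (fun x : ℝ => x ^ 2) (gaussianReal 0 (1 / 2)) :=
    MemLp.integrable_sq (memLp_id_gaussianReal 2)
  have hre : Integrable (fun z : ℂ => z.re ^ 2) stdComplexGaussian :=
    measurePreserving_re.integrable_comp_of_integrable hsq
  have him : Integrable (fun z : ℂ => z.im ^ 2) stdComplexGaussian :=
    measurePreserving_im.integrable_comp_of_integrable hsq
  simp_rw [← Complex.normSq_eq_norm_sq, Complex.normSq_apply, ← sq]
  rw [integral_add hre him,
    ← integral_map (φ := Complex.re) (f := fun x => x ^ 2) (by fun_prop) (by fun_prop),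
    ← integral_map (φ := Complex.im) (f := fun x => x ^ 2) (by fun_prop) (by fun_prop),
    measurePreserving_re.map_eq, measurePreserving_im.map_eq, integral_sq_gaussianReal]
  norm_num

/-! ### The transition density of the channel -/

instance (B N : ℕ) : IsProbabilityMeasure (fadingLaw B N) := by
  unfold fadingLaw; infer_instance

instance (B N L : ℕ) : IsProbabilityMeasure (noiseLaw B N L) := by
  unfold noiseLaw; infer_instance

section ChannelDensity

variable {B N L : ℕ} {Ω : Type*} [MeasurableSpace Ω]

/-- The matched-filter output of antenna `n` on subcarrier `b`, i.e. entry `n` of `Y[b] x[b]`. -/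
def matchedFilter (x : Input B L) (y : Output B N L) (b : Fin B) (n : Fin N) : ℂ :=
  ∑ l, y b n l * x b l

/-- The conditional density of the channel output given the input `x` and the fading `h`, with
respect to the noise law. -/
def coherentDensity (x : Input B L) (h : Fading B N) (y : Output B N L) : ℝ≥0∞ :=
  ∏ b, ∏ n, ENNReal.ofReal
    (Real.exp (2 * (star (h b n) * matchedFilter x y b n).re - ‖x b‖ ^ 2 * ‖h b n‖ ^ 2))

/-- The conditional density of the channel output given the input `x` only, with respect to the
noise law. -/
def channelDensity (x : Input B L) (y : Output B N L) : ℝ≥0∞ :=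
  ∏ b, ∏ n, ENNReal.ofReal ((1 + ‖x b‖ ^ 2)⁻¹ *
    Real.exp (‖matchedFilter x y b n‖ ^ 2 / (1 + ‖x b‖ ^ 2)))

@[fun_prop]
lemma measurable_matchedFilter {x : Ω → Input B L} {y : Ω → Output B N L} (hx : Measurable x)
    (hy : Measurable y) (b : Fin B) (n : Fin N) :
    Measurable fun ω => matchedFilter (x ω) (y ω) b n := by
  unfold matchedFilter
  fun_prop

@[fun_prop]
lemma measurable_coherentDensity {x : Ω → Input B L} {h : Ω → Fading B N} {y : Ω → Output B N L}
    (hx : Measurable x) (hh : Measurable h) (hy : Measurable y) :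
    Measurable fun ω => coherentDensity (x ω) (h ω) (y ω) := by
  unfold coherentDensity
  fun_prop

@[fun_prop]
lemma measurable_channelDensity {x : Ω → Input B L} {y : Ω → Output B N L} (hx : Measurable x)
    (hy : Measurable y) : Measurable fun ω => channelDensity (x ω) (y ω) := by
  unfold channelDensity
  fun_prop

@[fun_prop]
lemma measurable_channelOutput {x : Ω → Input B L} {h : Ω → Fading B N} {z : Ω → Output B N L}
    (hx : Measurable x) (hh : Measurable h) (hz : Measurable z) :
    Measurable fun ω => channelOutput (x ω) (h ω) (z ω) := by
  unfold channelOutput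
  fun_prop

lemma noiseLaw_map_add (c : Output B N L) :
    (noiseLaw B N L).map (fun z b n l => c b n l + z b n l) =
      (noiseLaw B N L).withDensity fun z => ∏ b, ∏ n, ∏ l,
        ENNReal.ofReal (Real.exp (2 * (star (c b n l) * z b n l).re - ‖c b n l‖ ^ 2)) := by
  unfold noiseLaw
  refine pi_map_eq_withDensity (T := fun b (z : Fin N → Fin L → ℂ) n l => c b n l + z n l)
    (f := fun b (z : Fin N → Fin L → ℂ) => ∏ n, ∏ l, ENNReal.ofReal
      (Real.exp (2 * (star (c b n l) * z n l).re - ‖c b n l‖ ^ 2)))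
    _ (by fun_prop) (by fun_prop) fun b => ?_
  refine pi_map_eq_withDensity (T := fun n (z : Fin L → ℂ) l => c b n l + z l)
    (f := fun n (z : Fin L → ℂ) => ∏ l, ENNReal.ofReal
      (Real.exp (2 * (star (c b n l) * z l).re - ‖c b n l‖ ^ 2)))
    _ (by fun_prop) (by fun_prop) fun n => ?_
  exact pi_map_eq_withDensity (T := fun l (z : ℂ) => c b n l + z)
    (f := fun l (z : ℂ) => ENNReal.ofReal
      (Real.exp (2 * (star (c b n l) * z).re - ‖c b n l‖ ^ 2)))
    _ (by fun_prop) (by fun_prop) fun l => stdComplexGaussian_map_add _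

lemma noiseLaw_map_channelOutput (x : Input B L) (h : Fading B N) :
    (noiseLaw B N L).map (channelOutput x h) =
      (noiseLaw B N L).withDensity (coherentDensity x h) := by
  refine (noiseLaw_map_add fun b n l => h b n * star (x b l)).trans ?_
  congr 1
  funext y
  refine Finset.prod_congr rfl fun b _ => Finset.prod_congr rfl fun n _ => ?_
  have hinner : ∑ l, 2 * (star (h b n * star (x b l)) * y b n l).re =
      2 * (star (h b n) * matchedFilter x y b n).re := by
    rw [matchedFilter, Finset.mul_sum, Complex.re_sum, Finset.mul_sum]
    refine Finset.sum_congr rfl fun l _ => ?_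
    rw [star_mul, star_star]
    congr 2
    ring
  have hnorm : ∑ l, ‖h b n * star (x b l)‖ ^ 2 = ‖x b‖ ^ 2 * ‖h b n‖ ^ 2 := by
    simp_rw [norm_mul, norm_star, mul_pow, ← Finset.mul_sum]
    rw [EuclideanSpace.norm_sq_eq, mul_comm]
  rw [← ENNReal.ofReal_prod_of_nonneg fun _ _ => (Real.exp_pos _).le, ← Real.exp_sum,
    Finset.sum_sub_distrib, hinner, hnorm]

lemma lintegral_coherentDensity (x : Input B L) (y : Output B N L) :
    ∫⁻ h, coherentDensity x h y ∂fadingLaw B N = channelDensity x y := by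
  unfold fadingLaw coherentDensity channelDensity
  rw [lintegral_pi_prod _ (f := fun b (h : Fin N → ℂ) => ∏ n, ENNReal.ofReal (Real.exp
    (2 * (star (h n) * matchedFilter x y b n).re - ‖x b‖ ^ 2 * ‖h n‖ ^ 2))) (by fun_prop)]
  refine Finset.prod_congr rfl fun b _ => ?_
  rw [lintegral_pi_prod _ (f := fun n (h : ℂ) => ENNReal.ofReal (Real.exp
    (2 * (star h * matchedFilter x y b n).re - ‖x b‖ ^ 2 * ‖h‖ ^ 2))) (by fun_prop)]
  refine Finset.prod_congr rfl fun n _ => ?_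
  exact lintegral_exp_quadratic_stdComplexGaussian (‖x b‖₊ ^ 2) (matchedFilter x y b n)

lemma lintegral_channelOutput (x : Input B L) {F : Output B N L → ℝ≥0∞} (hF : Measurable F) :
    ∫⁻ p, F (channelOutput x p.1 p.2) ∂((fadingLaw B N).prod (noiseLaw B N L)) =
      ∫⁻ y, channelDensity x y * F y ∂noiseLaw B N L := by
  calc ∫⁻ p, F (channelOutput x p.1 p.2) ∂((fadingLaw B N).prod (noiseLaw B N L))
      = ∫⁻ h, ∫⁻ z, F (channelOutput x h z) ∂noiseLaw B N L ∂fadingLaw B N :=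
        lintegral_prod (fun p : Fading B N × Output B N L => F (channelOutput x p.1 p.2))
          (by fun_prop)
    _ = ∫⁻ h, ∫⁻ y, coherentDensity x h y * F y ∂noiseLaw B N L ∂fadingLaw B N := by
        refine lintegral_congr fun h => ?_
        rw [← lintegral_map hF (by fun_prop), noiseLaw_map_channelOutput,
          lintegral_withDensity_eq_lintegral_mul _ (by fun_prop) hF]
        rfl
    _ = ∫⁻ y, ∫⁻ h, coherentDensity x h y * F y ∂fadingLaw B N ∂noiseLaw B N L :=
        lintegral_lintegral_swap (by fun_prop)
    _ = ∫⁻ y, channelDensity x y * F y ∂noiseLaw B N L := by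
        refine lintegral_congr fun y => ?_
        rw [lintegral_mul_const _ (by fun_prop), lintegral_coherentDensity]

lemma map_channelOutput_eq_withDensity (p : Measure Ω) [SFinite p] {enc : Ω → Input B L}
    (henc : Measurable enc) :
    (p.prod ((fadingLaw B N).prod (noiseLaw B N L))).map
      (fun ω => (ω.1, channelOutput (enc ω.1) ω.2.1 ω.2.2)) =
    (p.prod (noiseLaw B N L)).withDensity fun q => channelDensity (enc q.1) q.2 := by
  refine Measure.ext_of_lintegral _ fun F hF => ?_
  rw [lintegral_map hF (by fun_prop), lintegral_withDensity_eq_lintegral_mul _ (by fun_prop) hF,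
    lintegral_prod (fun ω : Ω × Fading B N × Output B N L =>
      F (ω.1, channelOutput (enc ω.1) ω.2.1 ω.2.2)) (by fun_prop),
    lintegral_prod _ (by fun_prop)]
  exact lintegral_congr fun ω => lintegral_channelOutput (enc ω) (F := fun y => F (ω, y))
    (by fun_prop)

end ChannelDensity

/-! ### Second moments of the channel output -/

lemma integral_star_sum_mul_sum_of_orthonormal {ι Ω : Type*} [Fintype ι] [DecidableEq ι]
    [MeasurableSpace Ω] {μ : Measure Ω} {X : ι → Ω → ℂ} (hX : ∀ i, MemLp (X i) 2 μ)
    (horth : ∀ i j, ∫ ω, star (X i ω) * X j ω ∂μ = if i = j then 1 else 0) (c d : ι → ℂ) :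
    ∫ ω, star (∑ i, c i * X i ω) * ∑ j, d j * X j ω ∂μ = ∑ i, star (c i) * d i := by
  have hint (i j) : Integrable (fun ω => star (c i) * d j * (star (X i ω) * X j ω)) μ :=
    ((hX i).star.integrable_mul (hX j)).const_mul _
  have hexpand (ω) : star (∑ i, c i * X i ω) * ∑ j, d j * X j ω =
      ∑ i, ∑ j, star (c i) * d j * (star (X i ω) * X j ω) := by
    rw [star_sum, Finset.sum_mul_sum]
    refine Finset.sum_congr rfl fun i _ => Finset.sum_congr rfl fun j _ => ?_
    rw [star_mul]
    ring
  simp_rw [hexpand]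
  rw [integral_finsetSum _ fun i _ => integrable_finsetSum _ fun j _ => hint i j]
  refine Finset.sum_congr rfl fun i _ => ?_
  rw [integral_finsetSum _ fun j _ => hint i j]
  simp_rw [integral_const_mul, horth, mul_ite, mul_one, mul_zero, Finset.sum_ite_eq,
    Finset.mem_univ, if_true]

lemma integral_star_mul_self_eq_integral_norm_sq {Ω : Type*} [MeasurableSpace Ω] (μ : Measure Ω)
    (X : Ω → ℂ) : ∫ ω, star (X ω) * X ω ∂μ = ((∫ ω, ‖X ω‖ ^ 2 ∂μ : ℝ) : ℂ) := by
  rw [← integral_complex_ofReal]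
  simp only [Complex.star_def, Complex.conj_mul', Complex.ofReal_pow]

lemma integral_star_stdComplexGaussian : ∫ z, star z ∂stdComplexGaussian = 0 := by
  have hconj := integral_conj (μ := stdComplexGaussian) (f := fun z : ℂ => z)
  rwa [integral_stdComplexGaussian, map_zero] at hconj

/-- The law of the fading coefficient and the noise seen by one antenna on one subcarrier. -/
def rowLaw (L : ℕ) : Measure (ℂ × (Fin L → ℂ)) :=
  stdComplexGaussian.prod (Measure.pi fun _ => stdComplexGaussian)

instance (L : ℕ) : IsProbabilityMeasure (rowLaw L) := by unfold rowLaw; infer_instance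

section RowLaw

variable {L : ℕ}

lemma measurePreserving_elim_rowLaw (k : Option (Fin L)) :
    MeasurePreserving (fun r : ℂ × (Fin L → ℂ) => (k.elim r.1 r.2 : ℂ)) (rowLaw L)
      stdComplexGaussian := by
  cases k with
  | none => exact measurePreserving_fst
  | some l =>
    exact (measurePreserving_eval (fun _ : Fin L => stdComplexGaussian) l).comp
      measurePreserving_snd

lemma memLp_elim_rowLaw (k : Option (Fin L)) (p : ℝ≥0) :
    MemLp (fun r : ℂ × (Fin L → ℂ) => k.elim r.1 r.2) p (rowLaw L) :=
  (memLp_stdComplexGaussian p).comp_measurePreserving (measurePreserving_elim_rowLaw k)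

lemma integral_star_elim_mul_elim_rowLaw (j k : Option (Fin L)) :
    ∫ r, star (j.elim r.1 r.2) * k.elim r.1 r.2 ∂rowLaw L = if j = k then 1 else 0 := by
  have hcoord (l : Fin L) : ∫ z : Fin L → ℂ, z l ∂Measure.pi (fun _ => stdComplexGaussian) = 0 :=
    (integral_comp_eval (μ := fun _ => stdComplexGaussian) (i := l) (f := fun z : ℂ => z)
      (by fun_prop)).trans integral_stdComplexGaussian
  have hcoord' (l : Fin L) :
      ∫ z : Fin L → ℂ, star (z l) ∂Measure.pi (fun _ => stdComplexGaussian) = 0 :=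
    (integral_comp_eval (μ := fun _ => stdComplexGaussian) (i := l) (f := fun z : ℂ => star z)
      (by fun_prop)).trans integral_star_stdComplexGaussian
  have hdiag (k : Option (Fin L)) : ∫ r, ‖(k.elim r.1 r.2 : ℂ)‖ ^ 2 ∂rowLaw L = 1 := by
    have hmap := measurePreserving_elim_rowLaw k
    rw [← integral_norm_sq_stdComplexGaussian, ← hmap.map_eq]
    exact (integral_map (f := fun z => ‖z‖ ^ 2) hmap.aemeasurable (by fun_prop)).symm
  rcases eq_or_ne j k with rfl | hjk
  · rw [integral_star_mul_self_eq_integral_norm_sq, hdiag, if_pos rfl, Complex.ofReal_one]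
  rw [if_neg hjk]
  rcases j with _ | l <;> rcases k with _ | m <;> simp only [Option.elim, rowLaw]
  · exact absurd rfl hjk
  · rw [integral_prod_mul (fun z => star z) (fun z : Fin L → ℂ => z m), hcoord, mul_zero]
  · simp_rw [mul_comm (star _)]
    rw [integral_prod_mul (fun z => z) (fun z : Fin L → ℂ => star (z l)), hcoord', mul_zero]
  · rw [integral_fun_snd (fun z : Fin L → ℂ => star (z l) * z m)]
    have hlm : l ≠ m := fun h => hjk (congrArg some h)
    have hind : (fun z : Fin L → ℂ => star (z l)) ⟂ᵢ[Measure.pi fun _ => stdComplexGaussian]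
        fun z => z m :=
      ((iIndepFun_pi (X := fun _ z => z) fun _ => by fun_prop).indepFun hlm).comp
        (φ := star) (ψ := id) (by fun_prop) measurable_id
    rw [hind.integral_fun_mul_eq_mul_integral
      (continuous_apply l).star.aestronglyMeasurable
      (measurable_pi_apply m).aestronglyMeasurable, hcoord, mul_zero, smul_zero]

lemma sum_option_elim_mul (α : ℂ) (c : Fin L → ℂ) (r : ℂ × (Fin L → ℂ)) :
    ∑ k : Option (Fin L), k.elim α c * k.elim r.1 r.2 = α * r.1 + ∑ l, c l * r.2 l :=
  Fintype.sum_option _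

lemma memLp_rowLaw (α : ℂ) (c : Fin L → ℂ) (p : ℝ≥0) :
    MemLp (fun r => α * r.1 + ∑ l, c l * r.2 l) p (rowLaw L) := by
  simp_rw [← sum_option_elim_mul]
  exact memLp_finsetSum _ fun k _ => (memLp_elim_rowLaw k p).const_mul _

lemma integral_star_mul_rowLaw (α β : ℂ) (c d : Fin L → ℂ) :
    ∫ r, star (α * r.1 + ∑ l, c l * r.2 l) * (β * r.1 + ∑ l, d l * r.2 l) ∂rowLaw L =
      star α * β + ∑ l, star (c l) * d l := by
  simp_rw [← sum_option_elim_mul]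
  rw [integral_star_sum_mul_sum_of_orthonormal (fun k => memLp_elim_rowLaw k 2)
    integral_star_elim_mul_elim_rowLaw]
  exact Fintype.sum_option _

lemma integral_norm_sq_rowLaw (α : ℂ) (c : Fin L → ℂ) :
    ∫ r, ‖α * r.1 + ∑ l, c l * r.2 l‖ ^ 2 ∂rowLaw L = ‖α‖ ^ 2 + ∑ l, ‖c l‖ ^ 2 := by
  apply Complex.ofReal_injective
  rw [← integral_star_mul_self_eq_integral_norm_sq, integral_star_mul_rowLaw]
  simp only [Complex.star_def, Complex.conj_mul', Complex.ofReal_add, Complex.ofReal_sum,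
    Complex.ofReal_pow]

end RowLaw

lemma measurePreserving_row {B N : ℕ} (L : ℕ) (b : Fin B) (n : Fin N) :
    MeasurePreserving (fun p : Fading B N × Output B N L => (p.1 b n, p.2 b n))
      ((fadingLaw B N).prod (noiseLaw B N L)) (rowLaw L) :=
  ((measurePreserving_eval (fun _ : Fin N => stdComplexGaussian) n).comp
    (measurePreserving_eval (fun _ : Fin B => Measure.pi fun _ : Fin N => stdComplexGaussian)
      b)).prod
  ((measurePreserving_eval
    (fun _ : Fin N => Measure.pi fun _ : Fin L => stdComplexGaussian) n).comp
    (measurePreserving_eval (fun _ : Fin B => Measure.pi fun _ : Fin N =>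
      Measure.pi fun _ : Fin L => stdComplexGaussian) b))

/-! ### Energy quantization -/

/-- The weights of a heavy-tailed prior on `ℕ` with all but `δ` of its mass at zero. -/
def gridWeight (δ : ℝ) : ℕ → ℝ
  | 0 => 1 - δ
  | k + 1 => δ / ((k + 1) * (k + 2))

section GridWeight

variable {δ : ℝ}

lemma gridWeight_pos (h0 : 0 < δ) (h1 : δ < 1) (k : ℕ) : 0 < gridWeight δ k := by
  cases k with
  | zero => exact sub_pos.2 h1
  | succ k => simp only [gridWeight]; positivity

lemma sum_range_gridWeight (δ : ℝ) (n : ℕ) :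
    ∑ i ∈ Finset.range (n + 1), gridWeight δ i = 1 - δ * (1 / ((n : ℝ) + 1)) := by
  induction n with
  | zero => simp [gridWeight]
  | succ n ih =>
    rw [Finset.sum_range_succ, ih]
    simp only [gridWeight]
    push_cast
    field_simp
    ring

lemma hasSum_gridWeight (h0 : 0 < δ) (h1 : δ < 1) : HasSum (gridWeight δ) 1 := by
  rw [hasSum_iff_tendsto_nat_of_nonneg fun k => (gridWeight_pos h0 h1 k).le,
    ← tendsto_add_atTop_iff_nat 1]
  simp_rw [sum_range_gridWeight]
  have htail := (tendsto_one_div_add_atTop_nhds_zero_nat (𝕜 := ℝ)).const_mul δ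
  simpa only [mul_zero, sub_zero] using htail.const_sub 1

lemma gridWeight_le_one (h0 : 0 < δ) (h1 : δ < 1) (k : ℕ) : gridWeight δ k ≤ 1 :=
  le_hasSum (hasSum_gridWeight h0 h1) k fun j _ => (gridWeight_pos h0 h1 j).le

lemma neg_log_gridWeight_zero_le (h1 : δ < 1) : -Real.log (gridWeight δ 0) ≤ δ / (1 - δ) := by
  have h1' : 0 < 1 - δ := sub_pos.2 h1
  have hlog := Real.one_sub_inv_le_log_of_pos h1'
  have hinv : 1 - (1 - δ)⁻¹ = -(δ / (1 - δ)) := by field_simp; ring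
  simp only [gridWeight]
  linarith

lemma neg_log_gridWeight_le (h0 : 0 < δ) {k : ℕ} (hk : k ≠ 0) {x : ℝ} (hx : k ≤ x) :
    -Real.log (gridWeight δ k) ≤ -Real.log δ + 2 * Real.log (1 + x) := by
  obtain ⟨k, rfl⟩ := Nat.exists_eq_succ_of_ne_zero hk
  push_cast at hx
  have hlog1 : Real.log ((k : ℝ) + 1) ≤ Real.log (1 + x) :=
    Real.log_le_log (by positivity) (by linarith)
  have hlog2 : Real.log ((k : ℝ) + 2) ≤ Real.log (1 + x) :=
    Real.log_le_log (by positivity) (by linarith)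
  simp only [gridWeight]
  rw [Real.log_div h0.ne' (by positivity), Real.log_mul (by positivity) (by positivity)]
  linarith

end GridWeight

/-- The probability law with weights `gridWeight δ` on the grid `{k / s}`: the receiver's prior for
the energy in the upper bound on the OED capacity. -/
def gridPrior (δ s : ℝ) : Measure ℝ :=
  Measure.sum fun k : ℕ => ENNReal.ofReal (gridWeight δ k) • Measure.dirac ((k : ℝ) / s)

lemma isProbabilityMeasure_gridPrior {δ : ℝ} (h0 : 0 < δ) (h1 : δ < 1) (s : ℝ) :
    IsProbabilityMeasure (gridPrior δ s) := by
  constructor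
  rw [gridPrior, Measure.sum_apply _ MeasurableSet.univ]
  simp only [Measure.smul_apply, measure_univ, smul_eq_mul, mul_one]
  rw [← ENNReal.ofReal_tsum_of_nonneg (fun k => (gridWeight_pos h0 h1 k).le)
    (hasSum_gridWeight h0 h1).summable, (hasSum_gridWeight h0 h1).tsum_eq, ENNReal.ofReal_one]

lemma gridWeight_le_gridPrior (δ s : ℝ) (k : ℕ) :
    ENNReal.ofReal (gridWeight δ k) ≤ gridPrior δ s {(k : ℝ) / s} := by
  rw [gridPrior, Measure.sum_apply _ (measurableSet_singleton _)]
  refine le_trans (le_of_eq ?_) (ENNReal.le_tsum k)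
  rw [Measure.smul_apply, Measure.dirac_apply_of_mem (Set.mem_singleton _), smul_eq_mul, mul_one]

/-- The quantization of an energy `a` to the grid `{k / s}`, rounding down. -/
def quantize (s a : ℝ) : ℝ := ⌊s * a⌋₊ / s

/-- The part of the information density that depends on the energy alone, when the energy `a` is
compared with its quantization. -/
def energyCost (δ s : ℝ) (N : ℕ) (a : ℝ) : ℝ :=
  -Real.log (gridWeight δ ⌊s * a⌋₊) + N * Real.log ((1 + quantize s a) / (1 + a))

/-- The coefficient of the received energy in the information density. -/
def energyCoeff (s a : ℝ) : ℝ := 1 / (1 + quantize s a) - 1 / (1 + a)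

/-- The mean of the information density given the energy `a`; the mean received energy is
`N * (1 + a)`. -/
def quantCost (δ s : ℝ) (N : ℕ) (a : ℝ) : ℝ :=
  energyCost δ s N a + energyCoeff s a * (N * (1 + a))

section Quantize

variable {δ s a : ℝ}

lemma measurable_quantize (s : ℝ) : Measurable (quantize s) :=
  ((measurable_of_countable fun k : ℕ => (k : ℝ)).comp
    (Nat.measurable_floor.comp (measurable_const_mul s))).div_const s

@[fun_prop]
lemma measurable_energyCost (δ s : ℝ) (N : ℕ) : Measurable (energyCost δ s N) := by
  have hweight : Measurable fun a : ℝ => gridWeight δ ⌊s * a⌋₊ :=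
    (measurable_of_countable (gridWeight δ)).comp
      (Nat.measurable_floor.comp (measurable_const_mul s))
  have hquant := measurable_quantize s
  unfold energyCost
  fun_prop

@[fun_prop]
lemma measurable_energyCoeff (s : ℝ) : Measurable (energyCoeff s) := by
  have hquant := measurable_quantize s
  unfold energyCoeff
  fun_prop

@[fun_prop]
lemma measurable_quantCost (δ s : ℝ) (N : ℕ) : Measurable (quantCost δ s N) := by
  unfold quantCost
  fun_prop

lemma quantize_nonneg (hs : 0 < s) : 0 ≤ quantize s a := by
  unfold quantize
  positivity

lemma quantize_le (hs : 0 < s) (ha : 0 ≤ a) : quantize s a ≤ a := by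
  rw [quantize, div_le_iff₀ hs, mul_comm a]
  exact Nat.floor_le (by positivity)

lemma sub_quantize_le (hs : 0 < s) : a - quantize s a ≤ 1 / s := by
  have hfloor := (Nat.lt_floor_add_one (s * a)).le
  rw [quantize, sub_le_iff_le_add, ← add_div, le_div_iff₀ hs]
  linarith

lemma energyCoeff_nonneg (hs : 0 < s) (ha : 0 ≤ a) : 0 ≤ energyCoeff s a := by
  have := quantize_nonneg (a := a) hs
  have := quantize_le hs ha
  exact sub_nonneg.2 (one_div_le_one_div_of_le (by linarith) (by linarith))

lemma energyCoeff_mul_one_add_le (hs : 0 < s) (ha : 0 ≤ a) :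
    energyCoeff s a * (1 + a) ≤ 1 / s := by
  have hq := quantize_nonneg (a := a) hs
  have hqa := quantize_le hs ha
  calc energyCoeff s a * (1 + a) = (a - quantize s a) / (1 + quantize s a) := by
        rw [energyCoeff]; field_simp; ring
    _ ≤ a - quantize s a := div_le_self (by linarith) (by linarith)
    _ ≤ 1 / s := sub_quantize_le hs

lemma quantCost_eq (δ : ℝ) (hs : 0 < s) (N : ℕ) (ha : 0 ≤ a) :
    quantCost δ s N a = -Real.log (gridWeight δ ⌊s * a⌋₊) +
      N * (Real.log ((1 + quantize s a) / (1 + a)) + ((1 + a) / (1 + quantize s a) - 1)) := by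
  have hq := quantize_nonneg (a := a) hs
  rw [quantCost, energyCost, energyCoeff]
  field_simp
  ring

lemma log_ratio_add_nonneg {κ a : ℝ} (hκ : 0 ≤ κ) (ha : 0 ≤ a) :
    0 ≤ Real.log ((1 + κ) / (1 + a)) + ((1 + a) / (1 + κ) - 1) := by
  have hlog := Real.one_sub_inv_le_log_of_pos (show 0 < (1 + κ) / (1 + a) by positivity)
  rw [inv_div] at hlog
  linarith

lemma log_ratio_add_le_sq {κ a : ℝ} (hκ : 0 ≤ κ) (ha : 0 ≤ a) :
    Real.log ((1 + κ) / (1 + a)) + ((1 + a) / (1 + κ) - 1) ≤ (a - κ) ^ 2 := by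
  have hlog := Real.log_le_sub_one_of_pos (show 0 < (1 + κ) / (1 + a) by positivity)
  calc Real.log ((1 + κ) / (1 + a)) + ((1 + a) / (1 + κ) - 1)
      ≤ (1 + κ) / (1 + a) - 1 + ((1 + a) / (1 + κ) - 1) := by gcongr
    _ = (a - κ) ^ 2 / ((1 + κ) * (1 + a)) := by field_simp; ring
    _ ≤ (a - κ) ^ 2 := div_le_self (sq_nonneg _) (by nlinarith)

lemma quantCost_nonneg {N : ℕ} (h0 : 0 < δ) (h1 : δ < 1) (hs : 0 < s) (ha : 0 ≤ a) :
    0 ≤ quantCost δ s N a := by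
  have hweight : 0 ≤ -Real.log (gridWeight δ ⌊s * a⌋₊) := neg_nonneg.2
    (Real.log_nonpos (gridWeight_pos h0 h1 _).le (gridWeight_le_one h0 h1 _))
  have hratio := log_ratio_add_nonneg (quantize_nonneg (a := a) hs) ha
  rw [quantCost_eq δ hs N ha]
  positivity

-- The grid spacing `1 / √N` is the accuracy to which `N` antennas resolve the energy.
lemma quantCost_sqrt_le (δ : ℝ) {N : ℕ} (hN : 0 < N) (ha : 0 ≤ a) :
    quantCost δ √N N a ≤
      -Real.log (gridWeight δ ⌊√N * a⌋₊) + (√N * a - ⌊√N * a⌋₊) ^ 2 := by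
  have hs : 0 < √(N : ℝ) := Real.sqrt_pos.2 (Nat.cast_pos.2 hN)
  have hscale : (√N * a - ⌊√N * a⌋₊) ^ 2 = N * (a - quantize √N a) ^ 2 := by
    rw [← Real.sq_sqrt (Nat.cast_nonneg (α := ℝ) N), ← mul_pow, Real.sq_sqrt N.cast_nonneg,
      quantize]
    field_simp
  rw [quantCost_eq δ hs N ha, hscale]
  gcongr
  exact log_ratio_add_le_sq (quantize_nonneg hs) ha

lemma sub_floor_sq_le_one {x : ℝ} (hx : 0 ≤ x) : (x - ⌊x⌋₊) ^ 2 ≤ 1 := by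
  have := Nat.floor_le hx
  have := (Nat.lt_floor_add_one x).le
  exact pow_le_one₀ (by linarith) (by linarith)

lemma quantCost_sqrt_le_linear {N : ℕ} (h0 : 0 < δ) (h1 : δ < 1) (hN : 0 < N) (ha : 0 ≤ a) :
    quantCost δ √N N a ≤ δ / (1 - δ) + (3 - Real.log δ) * (√N * a) := by
  have hx : 0 ≤ √(N : ℝ) * a := by positivity
  have hlogδ := Real.log_nonpos h0.le h1.le
  refine (quantCost_sqrt_le δ hN ha).trans ?_
  rcases eq_or_ne ⌊√(N : ℝ) * a⌋₊ 0 with hk | hk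
  · have hx1 : √N * a < 1 := Nat.floor_eq_zero.1 hk
    have hweight := neg_log_gridWeight_zero_le h1
    rw [hk, Nat.cast_zero, sub_zero]
    nlinarith
  · have hx1 : 1 ≤ √N * a := (Nat.floor_pos).1 (Nat.pos_of_ne_zero hk)
    have hweight := neg_log_gridWeight_le h0 hk (Nat.floor_le hx)
    have hsq := sub_floor_sq_le_one hx
    have hlog := Real.log_le_sub_one_of_pos (show 0 < 1 + √N * a by positivity)
    have hδ : 0 ≤ δ / (1 - δ) := div_nonneg h0.le (sub_nonneg.2 h1.le)
    nlinarith

lemma quantCost_sqrt_le_log {N : ℕ} (h0 : 0 < δ) (h1 : δ ≤ 1 / 2) (hN : 0 < N) (ha : 0 ≤ a) :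
    quantCost δ √N N a ≤ 2 - Real.log δ + 2 * Real.log (1 + √N * a) := by
  have hx : 0 ≤ √(N : ℝ) * a := by positivity
  have hsq := sub_floor_sq_le_one hx
  refine (quantCost_sqrt_le δ hN ha).trans ?_
  rcases eq_or_ne ⌊√(N : ℝ) * a⌋₊ 0 with hk | hk
  · have hweight := neg_log_gridWeight_zero_le (δ := δ) (by linarith)
    have hδ : δ / (1 - δ) ≤ 1 := (div_le_one (by linarith)).2 (by linarith)
    have hlogδ := Real.log_nonpos h0.le (by linarith)
    have hlogx := Real.log_nonneg (show 1 ≤ 1 + √N * a by linarith)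
    rw [hk] at hsq ⊢
    linarith
  · have hweight := neg_log_gridWeight_le h0 hk (Nat.floor_le hx)
    linarith

end Quantize

/-! ### The channel density of energy–shape inputs -/

section EnergyShape

variable {B N L : ℕ} {a : Fin B → ℝ} {u : Input B L} {b : Fin B}

/-- The received energy on subcarrier `b` along the shape `u`. -/
def shapeEnergy (u : Input B L) (y : Output B N L) (b : Fin B) : ℝ :=
  ∑ n, ‖matchedFilter u y b n‖ ^ 2

@[fun_prop]
lemma measurable_shapeEnergy {Ω : Type*} [MeasurableSpace Ω] {u : Ω → Input B L}
    {y : Ω → Output B N L} (hu : Measurable u) (hy : Measurable y) (b : Fin B) :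
    Measurable fun ω => shapeEnergy (u ω) (y ω) b := by
  unfold shapeEnergy
  fun_prop

@[fun_prop]
lemma measurable_energyShape {Ω : Type*} [MeasurableSpace Ω] {a : Ω → Fin B → ℝ}
    {u : Ω → Input B L} (ha : Measurable a) (hu : Measurable u) :
    Measurable fun ω => energyShape (a ω) (u ω) := by
  unfold energyShape
  fun_prop

lemma norm_energyShape_sq (ha : 0 ≤ a b) (hu : ‖u b‖ = 1) : ‖energyShape a u b‖ ^ 2 = a b := by
  rw [energyShape, norm_smul, hu, mul_one, Complex.norm_real, Real.norm_eq_abs, sq_abs,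
    Real.sq_sqrt ha]

lemma sum_enorm_sq (v : EuclideanSpace ℂ (Fin L)) :
    ∑ l, ‖v l‖ₑ ^ 2 = ENNReal.ofReal (‖v‖ ^ 2) := by
  rw [EuclideanSpace.norm_sq_eq, ENNReal.ofReal_sum_of_nonneg fun _ _ => by positivity]
  simp_rw [ENNReal.ofReal_pow (norm_nonneg _), ofReal_norm]

lemma matchedFilter_energyShape (a : Fin B → ℝ) (u : Input B L) (y : Output B N L) (b : Fin B)
    (n : Fin N) : matchedFilter (energyShape a u) y b n = (√(a b) : ℝ) * matchedFilter u y b n := by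
  simp only [matchedFilter, energyShape, PiLp.smul_apply, smul_eq_mul, Finset.mul_sum]
  exact Finset.sum_congr rfl fun l _ => by ring

lemma matchedFilter_channelOutput_energyShape (a : Fin B → ℝ) (hu : ‖u b‖ = 1) (h : Fading B N)
    (z : Output B N L) (n : Fin N) :
    matchedFilter u (channelOutput (energyShape a u) h z) b n =
      (√(a b) : ℝ) * h b n + ∑ l, u b l * z b n l := by
  have hunit : ∑ l, u b l * star (u b l) = 1 := by
    simp_rw [Complex.star_def, Complex.mul_conj']
    rw [← Complex.ofReal_one, ← one_pow 2, ← hu, EuclideanSpace.norm_sq_eq]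
    push_cast
    rfl
  calc matchedFilter u (channelOutput (energyShape a u) h z) b n
      = ∑ l, ((√(a b) : ℝ) * h b n * (u b l * star (u b l)) + u b l * z b n l) := by
        simp only [matchedFilter, channelOutput, energyShape, PiLp.smul_apply, smul_eq_mul,
          star_mul', Complex.star_def, Complex.conj_ofReal]
        exact Finset.sum_congr rfl fun l _ => by ring
    _ = (√(a b) : ℝ) * h b n + ∑ l, u b l * z b n l := by
        rw [Finset.sum_add_distrib, ← Finset.mul_sum, hunit, mul_one]

lemma channelDensity_energyShape (ha : ∀ b, 0 ≤ a b) (hu : ∀ b, ‖u b‖ = 1) (y : Output B N L) :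
    channelDensity (energyShape a u) y = ENNReal.ofReal (Real.exp
      (∑ b, (-(N * Real.log (1 + a b)) + shapeEnergy u y b * (1 - 1 / (1 + a b))))) := by
  rw [channelDensity, Real.exp_sum, ENNReal.ofReal_prod_of_nonneg fun _ _ => (Real.exp_pos _).le]
  refine Finset.prod_congr rfl fun b _ => ?_
  have hpos : 0 < 1 + a b := by linarith [ha b]
  have hrow (n : Fin N) : (1 + ‖energyShape a u b‖ ^ 2)⁻¹ * Real.exp
      (‖matchedFilter (energyShape a u) y b n‖ ^ 2 / (1 + ‖energyShape a u b‖ ^ 2)) =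
      Real.exp (-Real.log (1 + a b) + ‖matchedFilter u y b n‖ ^ 2 * (1 - 1 / (1 + a b))) := by
    rw [norm_energyShape_sq (ha b) (hu b), matchedFilter_energyShape, norm_mul, mul_pow,
      Complex.norm_real, Real.norm_eq_abs, sq_abs, Real.sq_sqrt (ha b), Real.exp_add,
      Real.exp_neg, Real.exp_log hpos]
    congr 2
    field_simp
    ring
  simp_rw [hrow]
  rw [← ENNReal.ofReal_prod_of_nonneg fun _ _ => (Real.exp_pos _).le, ← Real.exp_sum,
    Finset.sum_add_distrib, ← Finset.sum_mul, ← shapeEnergy, Finset.sum_const, Finset.card_univ,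
    Fintype.card_fin, nsmul_eq_mul, mul_neg]

lemma lintegral_channelDensity (x : Input B L) :
    ∫⁻ y : Output B N L, channelDensity x y ∂noiseLaw B N L = 1 := by
  have htotal := lintegral_channelOutput (N := N) x (F := fun _ => 1) measurable_const
  simpa only [lintegral_const, measure_univ, mul_one] using htotal.symm

lemma lintegral_shapeEnergy (ha : 0 ≤ a b) (hu : ‖u b‖ = 1) :
    ∫⁻ p, ENNReal.ofReal (shapeEnergy u (channelOutput (energyShape a u) p.1 p.2) b)
      ∂((fadingLaw B N).prod (noiseLaw B N L)) = ENNReal.ofReal (N * (1 + a b)) := by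
  have hrow (n : Fin N) : ∫⁻ p : Fading B N × Output B N L, ENNReal.ofReal
      (‖(√(a b) : ℝ) * p.1 b n + ∑ l, u b l * p.2 b n l‖ ^ 2)
      ∂((fadingLaw B N).prod (noiseLaw B N L)) = ENNReal.ofReal (1 + a b) := by
    have hmeas : Measurable fun r : ℂ × (Fin L → ℂ) => ENNReal.ofReal
        (‖((√(a b) : ℝ) : ℂ) * r.1 + ∑ l, u b l * r.2 l‖ ^ 2) := by fun_prop
    refine ((measurePreserving_row L b n).lintegral_comp hmeas).trans ?_
    rw [← ofReal_integral_eq_lintegral_ofReal ((memLp_rowLaw _ _ 2).integrable_norm_pow two_ne_zero)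
      (ae_of_all _ fun r => by positivity), integral_norm_sq_rowLaw, Complex.norm_real,
      Real.norm_eq_abs, sq_abs, Real.sq_sqrt ha, ← EuclideanSpace.norm_sq_eq, hu, one_pow, add_comm]
  simp only [shapeEnergy, matchedFilter_channelOutput_energyShape a hu]
  simp_rw [ENNReal.ofReal_sum_of_nonneg fun _ _ => sq_nonneg _]
  rw [lintegral_finsetSum _ fun n _ => by fun_prop]
  simp_rw [hrow]
  rw [Finset.sum_const, Finset.card_univ, Fintype.card_fin, nsmul_eq_mul,
    ENNReal.ofReal_mul N.cast_nonneg, ENNReal.ofReal_natCast]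

end EnergyShape

section OEDInput

variable {B L : ℕ} {P : ℝ} {pa : Measure (Fin B → ℝ)} {pu : Measure (Input B L)}

lemma ae_prod_energy_nonneg_and_norm_eq_one [SFinite pa] [SFinite pu]
    (ha : ∀ᵐ a ∂pa, ∀ b, 0 ≤ a b) (hu : ∀ᵐ u ∂pu, ∀ b, ‖u b‖ = 1) :
    ∀ᵐ ω ∂pa.prod pu, (∀ b, 0 ≤ ω.1 b) ∧ ∀ b, ‖ω.2 b‖ = 1 :=
  (Measure.quasiMeasurePreserving_fst.ae ha).and (Measure.quasiMeasurePreserving_snd.ae hu)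

lemma avgPower_map_energyShape [SFinite pa] [IsProbabilityMeasure pu]
    (ha : ∀ᵐ a ∂pa, ∀ b, 0 ≤ a b) (hu : ∀ᵐ u ∂pu, ∀ b, ‖u b‖ = 1) :
    avgPower ((pa.prod pu).map fun ω => energyShape ω.1 ω.2) =
      (∑ b, ∫⁻ a, ENNReal.ofReal (a b) ∂pa) / L := by
  have henergy : ∫⁻ ω, (∑ b, ∑ l, ‖energyShape ω.1 ω.2 b l‖ₑ ^ 2) / (L : ℝ≥0∞) ∂pa.prod pu =
      ∫⁻ ω : (Fin B → ℝ) × Input B L, (∑ b, ENNReal.ofReal (ω.1 b)) / (L : ℝ≥0∞)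
        ∂pa.prod pu := by
    refine lintegral_congr_ae ?_
    filter_upwards [ae_prod_energy_nonneg_and_norm_eq_one ha hu] with ω hω
    simp_rw [sum_enorm_sq, norm_energyShape_sq (hω.1 _) (hω.2 _)]
  rw [avgPower, lintegral_map (by fun_prop) (by fun_prop), henergy]
  simp_rw [div_eq_mul_inv]
  rw [lintegral_mul_const _ (by fun_prop), lintegral_prod _ (by fun_prop)]
  simp_rw [lintegral_const, measure_univ, mul_one]
  rw [lintegral_finsetSum _ fun b _ => by fun_prop]

lemma IsOEDInput.sum_lintegral_energy_le (h : IsOEDInput P pa pu) (hL : 0 < L) :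
    ∑ b, ∫⁻ a, ENNReal.ofReal (a b) ∂pa ≤ ENNReal.ofReal P * L := by
  have := h.isProbabilityMeasure_energy
  have := h.isProbabilityMeasure_shape
  have hpower := h.power
  rwa [avgPower_map_energyShape h.energy_nonneg h.shape_unit,
    ENNReal.div_le_iff (Nat.cast_ne_zero.2 hL.ne') (ENNReal.natCast_ne_top _)] at hpower

lemma IsOEDInput.integrable_energy (h : IsOEDInput P pa pu) (hL : 0 < L) (b : Fin B) :
    Integrable (fun a => a b) pa := by
  rw [← lintegral_ofReal_ne_top_iff_integrable (measurable_pi_apply b).aestronglyMeasurable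
    (h.energy_nonneg.mono fun a ha => ha b)]
  refine ne_top_of_le_ne_top ?_ ((Finset.single_le_sum (f := fun b =>
    ∫⁻ a, ENNReal.ofReal (a b) ∂pa) (fun _ _ => zero_le) (Finset.mem_univ b)).trans
    (h.sum_lintegral_energy_le hL))
  exact ENNReal.mul_ne_top ENNReal.ofReal_ne_top (ENNReal.natCast_ne_top _)

lemma IsOEDInput.sum_integral_energy_le (h : IsOEDInput P pa pu) (hP : 0 ≤ P) (hL : 0 < L) :
    ∑ b, ∫ a, a b ∂pa ≤ P * L := by
  have hnn (b) : 0 ≤ᵐ[pa] fun a => a b := h.energy_nonneg.mono fun a ha => ha b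
  have hsum := h.sum_lintegral_energy_le hL
  simp_rw [← ofReal_integral_eq_lintegral_ofReal (h.integrable_energy hL _) (hnn _)] at hsum
  rwa [← ENNReal.ofReal_sum_of_nonneg fun b _ => integral_nonneg_of_ae (hnn b),
    ← ENNReal.ofReal_natCast, ← ENNReal.ofReal_mul hP,
    ENNReal.ofReal_le_ofReal_iff (by positivity)] at hsum

end OEDInput

/-! ### Upper bound on the OED capacity -/

section GridDensity

variable {B N L : ℕ} {δ s : ℝ}

/-- The density of the output under the grid prior of the energies, given the shape `u`, with
respect to the noise law. -/
def gridDensity (δ s : ℝ) (u : Input B L) (y : Output B N L) : ℝ≥0∞ :=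
  ∫⁻ a, channelDensity (energyShape a u) y ∂Measure.pi fun _ : Fin B => gridPrior δ s

/-- An upper bound for the logarithm of the ratio of the channel density to `gridDensity`, as a
function of the energies, the shapes and the output. -/
def infoDensity (δ s : ℝ) (q : ((Fin B → ℝ) × Input B L) × Output B N L) : ℝ :=
  ∑ b, (energyCost δ s N (q.1.1 b) + energyCoeff s (q.1.1 b) * shapeEnergy q.1.2 q.2 b)

@[fun_prop]
lemma measurable_infoDensity (δ s : ℝ) :
    Measurable (infoDensity δ s : ((Fin B → ℝ) × Input B L) × Output B N L → ℝ) := by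
  unfold infoDensity
  fun_prop

lemma measurable_gridDensity (h0 : 0 < δ) (h1 : δ < 1) {Ω : Type*} [MeasurableSpace Ω]
    {u : Ω → Input B L} {y : Ω → Output B N L} (hu : Measurable u) (hy : Measurable y) :
    Measurable fun ω => gridDensity δ s (u ω) (y ω) := by
  have := isProbabilityMeasure_gridPrior h0 h1 s
  unfold gridDensity
  exact Measurable.lintegral_prod_right' (f := fun p : Ω × (Fin B → ℝ) =>
    channelDensity (energyShape p.2 (u p.1)) (y p.1)) (by fun_prop)

lemma lintegral_gridDensity (h0 : 0 < δ) (h1 : δ < 1) (u : Input B L) :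
    ∫⁻ y : Output B N L, gridDensity δ s u y ∂noiseLaw B N L = 1 := by
  have := isProbabilityMeasure_gridPrior h0 h1 s
  unfold gridDensity
  rw [lintegral_lintegral_swap (by fun_prop)]
  simp_rw [lintegral_channelDensity, lintegral_const, measure_univ, mul_one]

lemma prod_gridWeight_mul_channelDensity_le (h0 : 0 < δ) (h1 : δ < 1) (a : Fin B → ℝ)
    (u : Input B L) (y : Output B N L) :
    (∏ b, ENNReal.ofReal (gridWeight δ ⌊s * a b⌋₊)) *
      channelDensity (energyShape (fun b => quantize s (a b)) u) y ≤ gridDensity δ s u y := by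
  have := isProbabilityMeasure_gridPrior h0 h1 s
  set κ : Fin B → ℝ := fun b => quantize s (a b)
  calc (∏ b, ENNReal.ofReal (gridWeight δ ⌊s * a b⌋₊)) * channelDensity (energyShape κ u) y
      ≤ (Measure.pi fun _ : Fin B => gridPrior δ s) {κ} * channelDensity (energyShape κ u) y := by
        gcongr
        rw [← Set.univ_pi_singleton, Measure.pi_pi]
        exact Finset.prod_le_prod' fun b _ => gridWeight_le_gridPrior δ s _
    _ = ∫⁻ a' in {κ}, channelDensity (energyShape a' u) y
          ∂Measure.pi fun _ : Fin B => gridPrior δ s := by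
        rw [lintegral_singleton, mul_comm]
    _ ≤ gridDensity δ s u y := setLIntegral_le_lintegral _ _

lemma channelDensity_le_gridDensity_mul_exp (h0 : 0 < δ) (h1 : δ < 1) (hs : 0 < s)
    {a : Fin B → ℝ} {u : Input B L} (ha : ∀ b, 0 ≤ a b) (hu : ∀ b, ‖u b‖ = 1)
    (y : Output B N L) :
    channelDensity (energyShape a u) y ≤
      gridDensity δ s u y * ENNReal.ofReal (Real.exp (infoDensity δ s ((a, u), y))) := by
  have hq (b : Fin B) : 0 ≤ quantize s (a b) := quantize_nonneg hs
  have hweight : ∏ b, ENNReal.ofReal (gridWeight δ ⌊s * a b⌋₊) =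
      ENNReal.ofReal (Real.exp (∑ b, Real.log (gridWeight δ ⌊s * a b⌋₊))) := by
    simp_rw [Real.exp_sum, Real.exp_log (gridWeight_pos h0 h1 _)]
    rw [ENNReal.ofReal_prod_of_nonneg fun _ _ => (gridWeight_pos h0 h1 _).le]
  refine le_trans (le_of_eq ?_)
    (mul_le_mul_left (prod_gridWeight_mul_channelDensity_le (s := s) h0 h1 a u y) _)
  rw [channelDensity_energyShape ha hu, channelDensity_energyShape hq hu, hweight,
    ← ofReal_exp_add, ← ofReal_exp_add, infoDensity, ← Finset.sum_add_distrib,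
    ← Finset.sum_add_distrib]
  congr 3
  funext b
  have hpos : 0 < 1 + a b := by linarith [ha b]
  have hpos' : 0 < 1 + quantize s (a b) := by linarith [hq b]
  rw [energyCost, energyCoeff, Real.log_div hpos'.ne' hpos.ne']
  ring

end GridDensity

lemma map_withDensity_prod_prod {α β γ : Type*} [MeasurableSpace α] [MeasurableSpace β]
    [MeasurableSpace γ] (μ : Measure α) (ν : Measure β) (ξ : Measure γ) [SFinite μ] [SFinite ν]
    [SFinite ξ] {g : β × γ → ℝ≥0∞} (hg : Measurable g) :
    (((μ.prod ν).prod ξ).withDensity fun q => g (q.1.2, q.2)).map (fun q => (q.1.1, q.2)) =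
      μ.prod ((ν.prod ξ).withDensity g).snd := by
  have hassoc := map_withDensity_comp ((μ.prod ν).prod ξ)
    (MeasurableEquiv.prodAssoc (α := α) (β := β) (γ := γ)).measurable
    (g := fun q => g q.2) (by fun_prop)
  rw [Measure.prodAssoc_prod, ← prod_withDensity_right hg] at hassoc
  calc (((μ.prod ν).prod ξ).withDensity fun q => g (q.1.2, q.2)).map (fun q => (q.1.1, q.2))
      = ((((μ.prod ν).prod ξ).withDensity fun q => g (q.1.2, q.2)).map
          MeasurableEquiv.prodAssoc).map (Prod.map id Prod.snd) := by
        rw [Measure.map_map (by fun_prop) (MeasurableEquiv.measurable _)]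
        rfl
    _ = (μ.prod ((ν.prod ξ).withDensity g)).map (Prod.map id Prod.snd) := congrArg _ hassoc
    _ = μ.prod ((ν.prod ξ).withDensity g).snd := by
        rw [← Measure.map_prod_map _ _ measurable_id measurable_snd, Measure.map_id, Measure.snd]

lemma integrable_of_lintegral_ofReal_eq {α β : Type*} [MeasurableSpace α] [MeasurableSpace β]
    {μ : Measure α} {ν : Measure β} {f : α → ℝ} {g : β → ℝ} (hf : AEStronglyMeasurable f μ)
    (hf0 : 0 ≤ᵐ[μ] f) (hg : Integrable g ν) (hg0 : 0 ≤ᵐ[ν] g)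
    (h : ∫⁻ x, ENNReal.ofReal (f x) ∂μ = ∫⁻ y, ENNReal.ofReal (g y) ∂ν) : Integrable f μ := by
  rwa [← lintegral_ofReal_ne_top_iff_integrable hf hf0, h,
    lintegral_ofReal_ne_top_iff_integrable hg.aestronglyMeasurable hg0]

lemma integral_eq_of_lintegral_ofReal_eq {α β : Type*} [MeasurableSpace α] [MeasurableSpace β]
    {μ : Measure α} {ν : Measure β} {f : α → ℝ} {g : β → ℝ} (hf : AEStronglyMeasurable f μ)
    (hf0 : 0 ≤ᵐ[μ] f) (hg : AEStronglyMeasurable g ν) (hg0 : 0 ≤ᵐ[ν] g)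
    (h : ∫⁻ x, ENNReal.ofReal (f x) ∂μ = ∫⁻ y, ENNReal.ofReal (g y) ∂ν) :
    ∫ x, f x ∂μ = ∫ y, g y ∂ν := by
  rw [integral_eq_lintegral_of_nonneg_ae hf0 hf, h, integral_eq_lintegral_of_nonneg_ae hg0 hg]

/-- Joint law of the energies, the shapes and the outputs of an energy–shape input. -/
def shapeOutputLaw {B L : ℕ} (N : ℕ) (pa : Measure (Fin B → ℝ)) (pu : Measure (Input B L)) :
    Measure (((Fin B → ℝ) × Input B L) × Output B N L) :=
  ((pa.prod pu).prod ((fadingLaw B N).prod (noiseLaw B N L))).map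
    fun ω => (ω.1, channelOutput (energyShape ω.1.1 ω.1.2) ω.2.1 ω.2.2)

/-- Joint law of the energies, the shapes and an output drawn from `gridDensity` given the shapes
only. -/
def gridOutputLaw {B L : ℕ} (δ s : ℝ) (N : ℕ) (pa : Measure (Fin B → ℝ))
    (pu : Measure (Input B L)) : Measure (((Fin B → ℝ) × Input B L) × Output B N L) :=
  ((pa.prod pu).prod (noiseLaw B N L)).withDensity fun q => gridDensity δ s q.1.2 q.2

section OutputLaws

variable {B N L : ℕ} {δ s : ℝ} {pa : Measure (Fin B → ℝ)} {pu : Measure (Input B L)}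

lemma shapeOutputLaw_eq_withDensity [SFinite pa] [SFinite pu] :
    shapeOutputLaw N pa pu = ((pa.prod pu).prod (noiseLaw B N L)).withDensity
      fun q => channelDensity (energyShape q.1.1 q.1.2) q.2 :=
  map_channelOutput_eq_withDensity
    (enc := fun ω : (Fin B → ℝ) × Input B L => energyShape ω.1 ω.2) (pa.prod pu) (by fun_prop)

lemma map_shapeOutputLaw (pa : Measure (Fin B → ℝ)) (pu : Measure (Input B L)) :
    (shapeOutputLaw N pa pu).map (fun q => (q.1.1, q.2)) = energyOutputLaw N pa pu := by
  rw [shapeOutputLaw, Measure.map_map (by fun_prop) (by fun_prop)]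
  rfl

lemma lintegral_energyCoeff_mul_shapeEnergy [SFinite pa] [IsProbabilityMeasure pu]
    (ha : ∀ᵐ a ∂pa, ∀ b, 0 ≤ a b) (hu : ∀ᵐ u ∂pu, ∀ b, ‖u b‖ = 1) (hs : 0 < s) (b : Fin B) :
    ∫⁻ q, ENNReal.ofReal (energyCoeff s (q.1.1 b) * shapeEnergy q.1.2 q.2 b)
      ∂shapeOutputLaw N pa pu =
    ∫⁻ a, ENNReal.ofReal (energyCoeff s (a b) * (N * (1 + a b))) ∂pa := by
  have hfst : MeasurePreserving Prod.fst (pa.prod pu) pa := measurePreserving_fst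
  rw [shapeOutputLaw, lintegral_map (by fun_prop) (by fun_prop), lintegral_prod _ (by fun_prop),
    ← hfst.lintegral_comp (f := fun a => ENNReal.ofReal (energyCoeff s (a b) * (N * (1 + a b))))
      (by fun_prop)]
  refine lintegral_congr_ae ?_
  filter_upwards [ae_prod_energy_nonneg_and_norm_eq_one ha hu] with ω hω
  simp_rw [ENNReal.ofReal_mul (energyCoeff_nonneg hs (hω.1 b))]
  rw [lintegral_const_mul _ (by fun_prop), lintegral_shapeEnergy (hω.1 b) (hω.2 b)]

lemma ae_energyCoeff_mul_nonneg (ha : ∀ᵐ a ∂pa, ∀ b, 0 ≤ a b) (hs : 0 < s) (b : Fin B) :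
    0 ≤ᵐ[pa] fun a => energyCoeff s (a b) * (N * (1 + a b)) := by
  filter_upwards [ha] with a ha
  exact mul_nonneg (energyCoeff_nonneg hs (ha b)) (mul_nonneg N.cast_nonneg (by linarith [ha b]))

lemma integrable_energyCoeff_mul [IsFiniteMeasure pa] (ha : ∀ᵐ a ∂pa, ∀ b, 0 ≤ a b) (hs : 0 < s)
    (b : Fin B) : Integrable (fun a => energyCoeff s (a b) * (N * (1 + a b))) pa := by
  refine Integrable.of_bound (by fun_prop) (N * (1 / s)) ?_
  filter_upwards [ha] with a ha
  have hcoeff := energyCoeff_nonneg hs (ha b)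
  have hbound := energyCoeff_mul_one_add_le hs (ha b)
  have := ha b
  rw [Real.norm_of_nonneg (by positivity)]
  calc energyCoeff s (a b) * (N * (1 + a b)) = N * (energyCoeff s (a b) * (1 + a b)) := by ring
    _ ≤ N * (1 / s) := by gcongr

lemma measurePreserving_shapeOutputLaw [SFinite pa] [IsProbabilityMeasure pu] :
    MeasurePreserving (fun q => q.1.1) (shapeOutputLaw N pa pu) pa := by
  refine ⟨by fun_prop, ?_⟩
  rw [shapeOutputLaw, Measure.map_map (by fun_prop) (by fun_prop)]
  exact (measurePreserving_fst.comp measurePreserving_fst :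
    MeasurePreserving (Prod.fst ∘ Prod.fst)
      ((pa.prod pu).prod ((fadingLaw B N).prod (noiseLaw B N L))) pa).map_eq

section Probability

variable [IsProbabilityMeasure pa] [IsProbabilityMeasure pu]

instance : IsProbabilityMeasure (shapeOutputLaw N pa pu) :=
  Measure.isProbabilityMeasure_map (by fun_prop)

instance : IsProbabilityMeasure (energyOutputLaw N pa pu) :=
  Measure.isProbabilityMeasure_map (by fun_prop)

lemma isProbabilityMeasure_prod_withDensity_gridDensity (h0 : 0 < δ) (h1 : δ < 1) :
    IsProbabilityMeasure ((pu.prod (noiseLaw B N L)).withDensity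
      fun q => gridDensity δ s q.1 q.2) := by
  constructor
  rw [withDensity_apply _ MeasurableSet.univ, Measure.restrict_univ,
    lintegral_prod _ (measurable_gridDensity h0 h1 measurable_fst measurable_snd).aemeasurable]
  simp_rw [lintegral_gridDensity h0 h1, lintegral_const, measure_univ, mul_one]

lemma isProbabilityMeasure_gridOutputLaw (h0 : 0 < δ) (h1 : δ < 1) :
    IsProbabilityMeasure (gridOutputLaw δ s N pa pu) := by
  have hmeas : Measurable fun q : ((Fin B → ℝ) × Input B L) × Output B N L =>
      gridDensity δ s q.1.2 q.2 := measurable_gridDensity h0 h1 (by fun_prop) (by fun_prop)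
  constructor
  rw [gridOutputLaw, withDensity_apply _ MeasurableSet.univ, Measure.restrict_univ,
    lintegral_prod _ hmeas.aemeasurable]
  simp_rw [lintegral_gridDensity h0 h1, lintegral_const, measure_univ, mul_one]

lemma fst_energyOutputLaw : (energyOutputLaw N pa pu).fst = pa := by
  rw [← map_shapeOutputLaw, Measure.fst, Measure.map_map (by fun_prop) (by fun_prop)]
  exact measurePreserving_shapeOutputLaw.map_eq

-- Under the reference law the energies are independent of the output, so revealing the shapes to
-- the receiver turns the divergence into an upper bound for the information.
lemma klDiv_energyOutputLaw_le_klDiv_gridOutputLaw (h0 : 0 < δ) (h1 : δ < 1) :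
    klDiv (energyOutputLaw N pa pu)
      ((energyOutputLaw N pa pu).fst.prod (energyOutputLaw N pa pu).snd) ≤
      klDiv (shapeOutputLaw N pa pu) (gridOutputLaw δ s N pa pu) := by
  set Q := (pu.prod (noiseLaw B N L)).withDensity fun q => gridDensity δ s q.1 q.2
  have := isProbabilityMeasure_prod_withDensity_gridDensity (N := N) (pu := pu) (s := s) h0 h1
  have := isProbabilityMeasure_gridOutputLaw (N := N) (pa := pa) (pu := pu) (s := s) h0 h1
  have hmap : (gridOutputLaw δ s N pa pu).map (fun q => (q.1.1, q.2)) = pa.prod Q.snd :=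
    map_withDensity_prod_prod pa pu _ (g := fun q => gridDensity δ s q.1 q.2)
      (measurable_gridDensity h0 h1 measurable_fst measurable_snd)
  refine (klDiv_prod_marginals_le _ Q.snd).trans ?_
  rw [fst_energyOutputLaw, ← hmap, ← map_shapeOutputLaw]
  exact klDiv_map_le _ _ (by fun_prop)

lemma shapeOutputLaw_le_withDensity_exp (ha : ∀ᵐ a ∂pa, ∀ b, 0 ≤ a b)
    (hu : ∀ᵐ u ∂pu, ∀ b, ‖u b‖ = 1) (h0 : 0 < δ) (h1 : δ < 1) (hs : 0 < s) :
    shapeOutputLaw N pa pu ≤ (gridOutputLaw δ s N pa pu).withDensity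
      fun q => ENNReal.ofReal (Real.exp (infoDensity δ s q)) := by
  have hmeas : Measurable fun q : ((Fin B → ℝ) × Input B L) × Output B N L =>
      gridDensity δ s q.1.2 q.2 := measurable_gridDensity h0 h1 (by fun_prop) (by fun_prop)
  rw [shapeOutputLaw_eq_withDensity, gridOutputLaw, ← withDensity_mul _ hmeas (by fun_prop)]
  refine withDensity_mono ?_
  filter_upwards [Measure.quasiMeasurePreserving_fst.ae
    (ae_prod_energy_nonneg_and_norm_eq_one ha hu)] with q hq
  exact channelDensity_le_gridDensity_mul_exp h0 h1 hs hq.1 hq.2 q.2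

lemma integrable_energyCost (ha : ∀ᵐ a ∂pa, ∀ b, 0 ≤ a b) (hs : 0 < s) {b : Fin B}
    (hcost : Integrable (fun a => quantCost δ s N (a b)) pa) :
    Integrable (fun a => energyCost δ s N (a b)) pa := by
  refine (hcost.sub (integrable_energyCoeff_mul (N := N) ha hs b)).congr (ae_of_all _ fun a => ?_)
  simp only [Pi.sub_apply, quantCost, add_sub_cancel_right]

lemma ae_energyCoeff_mul_shapeEnergy_nonneg (ha : ∀ᵐ a ∂pa, ∀ b, 0 ≤ a b) (hs : 0 < s)
    (b : Fin B) : 0 ≤ᵐ[shapeOutputLaw N pa pu]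
      fun q => energyCoeff s (q.1.1 b) * shapeEnergy q.1.2 q.2 b := by
  filter_upwards [measurePreserving_shapeOutputLaw.quasiMeasurePreserving.ae ha] with q hq
  exact mul_nonneg (energyCoeff_nonneg hs (hq b)) (Finset.sum_nonneg fun n _ => by positivity)

lemma integrable_energyCoeff_mul_shapeEnergy (ha : ∀ᵐ a ∂pa, ∀ b, 0 ≤ a b)
    (hu : ∀ᵐ u ∂pu, ∀ b, ‖u b‖ = 1) (hs : 0 < s) (b : Fin B) :
    Integrable (fun q => energyCoeff s (q.1.1 b) * shapeEnergy q.1.2 q.2 b)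
      (shapeOutputLaw N pa pu) :=
  integrable_of_lintegral_ofReal_eq (by fun_prop) (ae_energyCoeff_mul_shapeEnergy_nonneg ha hs b)
    (integrable_energyCoeff_mul ha hs b) (ae_energyCoeff_mul_nonneg ha hs b)
    (lintegral_energyCoeff_mul_shapeEnergy ha hu hs b)

lemma integral_energyCoeff_mul_shapeEnergy (ha : ∀ᵐ a ∂pa, ∀ b, 0 ≤ a b)
    (hu : ∀ᵐ u ∂pu, ∀ b, ‖u b‖ = 1) (hs : 0 < s) (b : Fin B) :
    ∫ q, energyCoeff s (q.1.1 b) * shapeEnergy q.1.2 q.2 b ∂shapeOutputLaw N pa pu =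
      ∫ a, energyCoeff s (a b) * (N * (1 + a b)) ∂pa :=
  integral_eq_of_lintegral_ofReal_eq (by fun_prop) (ae_energyCoeff_mul_shapeEnergy_nonneg ha hs b)
    (by fun_prop) (ae_energyCoeff_mul_nonneg ha hs b)
    (lintegral_energyCoeff_mul_shapeEnergy ha hu hs b)

lemma integrable_energyCost_add (ha : ∀ᵐ a ∂pa, ∀ b, 0 ≤ a b) (hu : ∀ᵐ u ∂pu, ∀ b, ‖u b‖ = 1)
    (hs : 0 < s) {b : Fin B} (hcost : Integrable (fun a => quantCost δ s N (a b)) pa) :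
    Integrable (fun q => energyCost δ s N (q.1.1 b) +
      energyCoeff s (q.1.1 b) * shapeEnergy q.1.2 q.2 b) (shapeOutputLaw N pa pu) :=
  (measurePreserving_shapeOutputLaw.integrable_comp_of_integrable
    (integrable_energyCost ha hs hcost)).add (integrable_energyCoeff_mul_shapeEnergy ha hu hs b)

lemma integral_energyCost_add (ha : ∀ᵐ a ∂pa, ∀ b, 0 ≤ a b) (hu : ∀ᵐ u ∂pu, ∀ b, ‖u b‖ = 1)
    (hs : 0 < s) {b : Fin B} (hcost : Integrable (fun a => quantCost δ s N (a b)) pa) :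
    ∫ q, (energyCost δ s N (q.1.1 b) + energyCoeff s (q.1.1 b) * shapeEnergy q.1.2 q.2 b)
      ∂shapeOutputLaw N pa pu = ∫ a, quantCost δ s N (a b) ∂pa := by
  have hpres := measurePreserving_shapeOutputLaw (N := N) (pa := pa) (pu := pu)
  have henergy := integrable_energyCost ha hs hcost
  have henergy' : Integrable (fun q => energyCost δ s N (q.1.1 b)) (shapeOutputLaw N pa pu) :=
    hpres.integrable_comp_of_integrable henergy
  have hfst : ∫ q, energyCost δ s N (q.1.1 b) ∂shapeOutputLaw N pa pu =
      ∫ a, energyCost δ s N (a b) ∂pa := by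
    have hmeas : Measurable fun a : Fin B → ℝ => energyCost δ s N (a b) := by fun_prop
    rw [← integral_map hpres.aemeasurable hmeas.aestronglyMeasurable, hpres.map_eq]
  unfold quantCost
  rw [integral_add henergy' (integrable_energyCoeff_mul_shapeEnergy ha hu hs b), hfst,
    integral_energyCoeff_mul_shapeEnergy ha hu hs b,
    integral_add henergy (integrable_energyCoeff_mul ha hs b)]

lemma klDiv_energyOutputLaw_le (ha : ∀ᵐ a ∂pa, ∀ b, 0 ≤ a b) (hu : ∀ᵐ u ∂pu, ∀ b, ‖u b‖ = 1)
    (h0 : 0 < δ) (h1 : δ < 1) (hs : 0 < s)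
    (hcost : ∀ b, Integrable (fun a => quantCost δ s N (a b)) pa) :
    klDiv (energyOutputLaw N pa pu)
      ((energyOutputLaw N pa pu).fst.prod (energyOutputLaw N pa pu).snd) ≤
      ENNReal.ofReal (∑ b, ∫ a, quantCost δ s N (a b) ∂pa) := by
  have := isProbabilityMeasure_gridOutputLaw (N := N) (pa := pa) (pu := pu) (s := s) h0 h1
  have hterm (b : Fin B) := integrable_energyCost_add (N := N) (pu := pu) ha hu hs (hcost b)
  calc klDiv (energyOutputLaw N pa pu)
        ((energyOutputLaw N pa pu).fst.prod (energyOutputLaw N pa pu).snd)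
      ≤ klDiv (shapeOutputLaw N pa pu) (gridOutputLaw δ s N pa pu) :=
        klDiv_energyOutputLaw_le_klDiv_gridOutputLaw h0 h1
    _ ≤ ENNReal.ofReal (∫ q, infoDensity δ s q ∂shapeOutputLaw N pa pu) :=
        klDiv_le_of_le_withDensity_exp _ _ (integrable_finsetSum _ fun b _ => hterm b)
          (shapeOutputLaw_le_withDensity_exp ha hu h0 h1 hs)
    _ = ENNReal.ofReal (∑ b, ∫ a, quantCost δ s N (a b) ∂pa) := by
        simp only [infoDensity]
        rw [integral_finsetSum _ fun b _ => hterm b]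
        simp_rw [integral_energyCost_add ha hu hs (hcost _)]

end Probability

end OutputLaws

section OEDCapacity

variable {B N L : ℕ} {δ s P Δf c₀ c₁ : ℝ}

lemma IsOEDInput.klDiv_le_of_quantCost_le {pa : Measure (Fin B → ℝ)} {pu : Measure (Input B L)}
    (h : IsOEDInput P pa pu) (hP : 0 ≤ P) (hL : 0 < L) (h0 : 0 < δ) (h1 : δ < 1) (hs : 0 < s)
    (hc₁ : 0 ≤ c₁) (hcost : ∀ a : ℝ, 0 ≤ a → quantCost δ s N a ≤ c₀ + c₁ * a) :
    klDiv (energyOutputLaw N pa pu)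
      ((energyOutputLaw N pa pu).fst.prod (energyOutputLaw N pa pu).snd) ≤
      ENNReal.ofReal (B * c₀ + c₁ * (P * L)) := by
  have := h.isProbabilityMeasure_energy
  have := h.isProbabilityMeasure_shape
  have hlinear (b) : Integrable (fun a : Fin B → ℝ => c₀ + c₁ * a b) pa :=
    (integrable_const _).add ((h.integrable_energy hL b).const_mul _)
  have hquant (b) : Integrable (fun a => quantCost δ s N (a b)) pa := by
    have hmeas : Measurable fun a : Fin B → ℝ => quantCost δ s N (a b) := by fun_prop
    refine (hlinear b).mono' hmeas.aestronglyMeasurable ?_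
    filter_upwards [h.energy_nonneg] with a ha
    rw [Real.norm_of_nonneg (quantCost_nonneg h0 h1 hs (ha b))]
    exact hcost _ (ha b)
  refine (klDiv_energyOutputLaw_le h.energy_nonneg h.shape_unit h0 h1 hs hquant).trans
    (ENNReal.ofReal_le_ofReal ?_)
  calc ∑ b, ∫ a, quantCost δ s N (a b) ∂pa
      ≤ ∑ b, ∫ a, (c₀ + c₁ * a b) ∂pa := by
        refine Finset.sum_le_sum fun b _ => integral_mono_ae (hquant b) (hlinear b) ?_
        filter_upwards [h.energy_nonneg] with a ha using hcost _ (ha b)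
    _ = B * c₀ + c₁ * ∑ b, ∫ a, a b ∂pa := by
        simp_rw [integral_add (integrable_const c₀) ((h.integrable_energy hL _).const_mul c₁),
          integral_const_mul, Finset.sum_add_distrib, ← Finset.mul_sum]
        simp
    _ ≤ B * c₀ + c₁ * (P * L) := by
        gcongr
        exact h.sum_integral_energy_le hP hL

lemma oedCapacity_le_of_quantCost_le (hP : 0 ≤ P) (hΔf : 0 < Δf) (hL : 0 < L) (h0 : 0 < δ)
    (h1 : δ < 1) (hs : 0 < s) (hc₁ : 0 ≤ c₁)
    (hcost : ∀ a : ℝ, 0 ≤ a → quantCost δ s N a ≤ c₀ + c₁ * a) :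
    oedCapacity P Δf B N L ≤
      ENNReal.ofReal ((B * c₀ + c₁ * (P * L)) / Real.log 2 / (L / Δf)) := by
  have hL' : (0 : ℝ) < L := Nat.cast_pos.2 hL
  refine iSup_le fun pa => iSup_le fun pu => iSup_le fun h => ?_
  rw [ENNReal.ofReal_div_of_pos (div_pos hL' hΔf),
    ENNReal.ofReal_div_of_pos (Real.log_pos one_lt_two), ENNReal.ofReal_div_of_pos hΔf,
    ENNReal.ofReal_natCast, mutualInfo]
  gcongr
  exact h.klDiv_le_of_quantCost_le hP hL h0 h1 hs hc₁ hcost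

/-- The bound on the OED capacity that charges every subcarrier in proportion to its energy. -/
def energyRateBound (P Δf : ℝ) (B N L : ℕ) : ℝ :=
  (1 + (Real.log (B + 1) + 3) * √N * (P * L)) / Real.log 2 / (L / Δf)

lemma oedCapacity_le_energyRateBound (hP : 0 ≤ P) (hΔf : 0 < Δf) (hB : 0 < B) (hN : 0 < N)
    (hL : 0 < L) : oedCapacity P Δf B N L ≤ ENNReal.ofReal (energyRateBound P Δf B N L) := by
  have hB' : (0 : ℝ) < B := Nat.cast_pos.2 hB
  have hlog : 0 ≤ Real.log (B + 1) := Real.log_nonneg (by linarith)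
  have h1 : ((B : ℝ) + 1)⁻¹ < 1 := inv_lt_one_of_one_lt₀ (by linarith)
  have h0 : 0 < ((B : ℝ) + 1)⁻¹ := by positivity
  have hratio : ((B : ℝ) + 1)⁻¹ / (1 - ((B : ℝ) + 1)⁻¹) = 1 / B := by
    have : 1 - ((B : ℝ) + 1)⁻¹ = B * ((B : ℝ) + 1)⁻¹ := by field_simp; ring
    rw [this]
    field_simp
  have hbound := oedCapacity_le_of_quantCost_le (B := B) (c₀ := 1 / B)
    (c₁ := (Real.log (B + 1) + 3) * √N) hP hΔf hL h0 h1
    (Real.sqrt_pos.2 (Nat.cast_pos.2 hN)) (by positivity) fun a ha => by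
      refine (quantCost_sqrt_le_linear h0 h1 hN ha).trans_eq ?_
      rw [hratio, Real.log_inv]
      ring
  rwa [mul_one_div_cancel hB'.ne'] at hbound

lemma log_one_add_sqrt_mul_le (hN : 0 < N) (hL : 0 < L) {a : ℝ} (ha : 0 ≤ a) :
    Real.log (1 + √N * a) ≤ Real.log (N * L) + a / L := by
  have hN' : (1 : ℝ) ≤ N := Nat.one_le_cast.2 hN
  have hL' : (1 : ℝ) ≤ L := Nat.one_le_cast.2 hL
  have hNL : (1 : ℝ) ≤ N * L := one_le_mul_of_one_le_of_one_le hN' hL'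
  have hpos : 0 < 1 + √N * a := by positivity
  have hsqrt : √(N : ℝ) ≤ N := Real.sqrt_le_self_iff.2 (.inr hN')
  calc Real.log (1 + √N * a)
      = Real.log (N * L) + Real.log ((1 + √N * a) / (N * L)) := by
        rw [Real.log_div hpos.ne' (by positivity)]
        ring
    _ ≤ Real.log (N * L) + ((1 + √N * a) / (N * L) - 1) := by
        gcongr
        exact Real.log_le_sub_one_of_pos (by positivity)
    _ ≤ Real.log (N * L) + ((N * L + N * a) / (N * L) - 1) := by gcongr
    _ = Real.log (N * L) + a / L := by field_simp; ring

/-- The bound on the OED capacity that charges every subcarrier a logarithmic number of bits. -/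
def bandwidthRateBound (P Δf : ℝ) (B N L : ℕ) : ℝ :=
  (B * (Real.log (B + 1) + 2 * Real.log (N * L) + 2) + 2 * P) / Real.log 2 / (L / Δf)

lemma oedCapacity_le_bandwidthRateBound (hP : 0 ≤ P) (hΔf : 0 < Δf) (hB : 0 < B) (hN : 0 < N)
    (hL : 0 < L) :
    oedCapacity P Δf B N L ≤ ENNReal.ofReal (bandwidthRateBound P Δf B N L) := by
  have hB' : (1 : ℝ) ≤ B := Nat.one_le_cast.2 hB
  have : (0 : ℝ) < L := Nat.cast_pos.2 hL
  have h2 : ((B : ℝ) + 1)⁻¹ ≤ 1 / 2 := by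
    rw [one_div]
    gcongr
    linarith
  have h0 : 0 < ((B : ℝ) + 1)⁻¹ := by positivity
  have hbound := oedCapacity_le_of_quantCost_le (B := B)
    (c₀ := Real.log (B + 1) + 2 * Real.log (N * L) + 2) (c₁ := 2 / L) hP hΔf hL h0
    (h2.trans_lt one_half_lt_one) (Real.sqrt_pos.2 (Nat.cast_pos.2 hN)) (by positivity)
    fun a ha => by
      calc quantCost ((B : ℝ) + 1)⁻¹ √N N a
          ≤ 2 - Real.log ((B : ℝ) + 1)⁻¹ + 2 * Real.log (1 + √N * a) :=
            quantCost_sqrt_le_log h0 h2 hN ha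
        _ ≤ 2 - Real.log ((B : ℝ) + 1)⁻¹ + 2 * (Real.log (N * L) + a / L) := by
            gcongr
            exact log_one_add_sqrt_mul_le hN hL ha
        _ = Real.log (B + 1) + 2 * Real.log (N * L) + 2 + 2 / L * a := by
            rw [Real.log_inv]
            ring
  rwa [show 2 / (L : ℝ) * (P * L) = 2 * P by field_simp] at hbound

end OEDCapacity

/-! ### Independent bits sent through a noisy channel -/

section JointLaw

variable {X κ Y : Type*} [MeasurableSpace X] [MeasurableSpace κ] [MeasurableSpace Y]
  {q : Measure X} {W : Measure κ} {out : X → κ → Y}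

/-- The joint law of a random input and its output over a channel with independent noise. -/
def jointLaw (q : Measure X) (W : Measure κ) (out : X → κ → Y) : Measure (X × Y) :=
  (q.prod W).map fun ω => (ω.1, out ω.1 ω.2)

lemma isProbabilityMeasure_jointLaw [IsProbabilityMeasure q] [IsProbabilityMeasure W]
    (hout : Measurable fun ω : X × κ => out ω.1 ω.2) : IsProbabilityMeasure (jointLaw q W out) :=
  Measure.isProbabilityMeasure_map (measurable_fst.prodMk hout).aemeasurable

lemma fst_jointLaw [IsProbabilityMeasure W] (hout : Measurable fun ω : X × κ => out ω.1 ω.2) :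
    (jointLaw q W out).fst = q := by
  rw [jointLaw, Measure.fst_map_prodMk hout]
  exact measurePreserving_fst.map_eq

lemma jointLaw_prod [SFinite W] (hout : Measurable fun ω : X × κ => out ω.1 ω.2) {A : Set X}
    {S : Set Y} (hA : MeasurableSet A) (hS : MeasurableSet S) :
    jointLaw q W out (A ×ˢ S) = ∫⁻ x in A, W {k | out x k ∈ S} ∂q := by
  have hjoint : Measurable fun ω : X × κ => (ω.1, out ω.1 ω.2) := measurable_fst.prodMk hout
  rw [jointLaw, Measure.map_apply hjoint (hA.prod hS), Measure.prod_apply (hjoint (hA.prod hS)),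
    ← lintegral_indicator hA]
  congr with x
  by_cases hx : x ∈ A <;> simp [Set.preimage, hx]

section Encoder

variable {Ω : Type*} [MeasurableSpace Ω] {μ : Measure Ω} {enc : Ω → X} {A : Set X} {S : Set Y}

lemma jointLaw_map_prod [SFinite W] (henc : Measurable enc)
    (hout : Measurable fun ω : X × κ => out ω.1 ω.2) (hA : MeasurableSet A)
    (hS : MeasurableSet S) : jointLaw (μ.map enc) W out (A ×ˢ S) =
      ∫⁻ s in enc ⁻¹' A, W {k | out (enc s) k ∈ S} ∂μ := by
  rw [jointLaw_prod hout hA hS]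
  exact setLIntegral_map hA (measurable_measure_prodMk_left (hout hS)) henc

lemma mul_real_le_jointLaw_map_real_prod [IsProbabilityMeasure μ] [IsProbabilityMeasure W]
    (henc : Measurable enc) (hout : Measurable fun ω : X × κ => out ω.1 ω.2)
    (hA : MeasurableSet A) (hS : MeasurableSet S) {d : ℝ}
    (h : ∀ s, enc s ∈ A → d ≤ W.real {k | out (enc s) k ∈ S}) :
    d * (μ.map enc).real A ≤ (jointLaw (μ.map enc) W out).real (A ×ˢ S) := by
  have := Measure.isProbabilityMeasure_map henc.aemeasurable (μ := μ)
  have := isProbabilityMeasure_jointLaw (q := μ.map enc) (W := W) hout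
  rw [measureReal_def (jointLaw _ _ _), ← ENNReal.ofReal_le_iff_le_toReal (measure_ne_top _ _),
    jointLaw_map_prod henc hout hA hS, ENNReal.ofReal_mul' measureReal_nonneg, ofReal_measureReal,
    Measure.map_apply henc hA, ← setLIntegral_const]
  exact setLIntegral_mono' (henc hA) fun s hs =>
    (ENNReal.ofReal_le_iff_le_toReal (measure_ne_top _ _)).2 (h s hs)

lemma jointLaw_map_real_prod_le_mul_real [IsFiniteMeasure μ] [IsFiniteMeasure W]
    (henc : Measurable enc) (hout : Measurable fun ω : X × κ => out ω.1 ω.2)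
    (hA : MeasurableSet A) (hS : MeasurableSet S) {d : ℝ} (hd : 0 ≤ d)
    (h : ∀ s, enc s ∈ A → W.real {k | out (enc s) k ∈ S} ≤ d) :
    (jointLaw (μ.map enc) W out).real (A ×ˢ S) ≤ d * (μ.map enc).real A := by
  refine ENNReal.toReal_le_of_le_ofReal (by positivity) ?_
  rw [jointLaw_map_prod henc hout hA hS, ENNReal.ofReal_mul' measureReal_nonneg,
    ofReal_measureReal, Measure.map_apply henc hA, ← setLIntegral_const]
  exact setLIntegral_mono' (henc hA) fun s hs =>
    (ENNReal.le_ofReal_iff_toReal_le (measure_ne_top _ _) hd).2 (h s hs)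

end Encoder

end JointLaw

lemma iIndepSet_map {ι Ω X : Type*} [MeasurableSpace Ω] [MeasurableSpace X] {μ : Measure Ω}
    [IsProbabilityMeasure μ] {f : Ω → X} (hf : Measurable f) {A : ι → Set X}
    (hA : ∀ i, MeasurableSet (A i)) (hind : iIndepSet (fun i => f ⁻¹' A i) μ) :
    iIndepSet A (μ.map f) := by
  rw [iIndepSet_iff_meas_biInter hA]
  rw [iIndepSet_iff_meas_biInter fun i => hf (hA i)] at hind
  intro s
  rw [Measure.map_apply hf (Finset.measurableSet_biInter _ fun i _ => hA i)]
  simp only [Set.preimage_iInter]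
  simp_rw [hind s, Measure.map_apply hf (hA _)]

lemma iIndepSet_pi {ι : Type*} [Fintype ι] {α : ι → Type*} [∀ i, MeasurableSpace (α i)]
    {μ : ∀ i, Measure (α i)} [∀ i, IsProbabilityMeasure (μ i)] {s : ∀ i, Set (α i)}
    (hs : ∀ i, MeasurableSet (s i)) :
    iIndepSet (fun i => Function.eval i ⁻¹' s i) (Measure.pi μ) := by
  rw [iIndepSet_iff_meas_biInter fun i => measurable_pi_apply i (hs i)]
  intro t
  exact (iIndepFun_pi (μ := μ) (X := fun _ x => x) fun _ => aemeasurable_id).meas_biInter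
    fun i _ => ⟨s i, hs i, rfl⟩

lemma card_mul_le_klDiv_jointLaw_of_bits {ι X κ Y : Type*} [Fintype ι] [MeasurableSpace X]
    [MeasurableSpace κ] [MeasurableSpace Y] (p : unitInterval) (W : Measure κ)
    [IsProbabilityMeasure W] {enc : (ι → Bool) → X} {out : X → κ → Y}
    (hout : Measurable fun ω : X × κ => out ω.1 ω.2) {A : ι → Set X}
    (hA : ∀ i, MeasurableSet (A i)) (hencA : ∀ s i, enc s ∈ A i ↔ s i = true) {S : ι → Set Y}
    (hS : ∀ i, MeasurableSet (S i))
    (hhit : ∀ s i, s i = true → 3 / 4 ≤ W.real {k | out (enc s) k ∈ S i})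
    (hmiss : ∀ s i, s i = false → W.real {k | out (enc s) k ∈ S i} ≤ 1 / 4) {ρ : Measure (X × Y)}
    (hρ : ρ = jointLaw ((Measure.pi fun _ => bernoulliMeasure true false p).map enc) W out) :
    ENNReal.ofReal (Fintype.card ι * (p * (1 - p)) / 16) ≤ klDiv ρ (ρ.fst.prod ρ.snd) := by
  have henc : Measurable enc := measurable_of_countable _
  set q := (Measure.pi fun _ : ι => bernoulliMeasure true false p).map enc with hq
  have : IsProbabilityMeasure q := Measure.isProbabilityMeasure_map henc.aemeasurable
  have : IsProbabilityMeasure ρ := hρ ▸ isProbabilityMeasure_jointLaw hout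
  have hfst : ρ.fst = q := hρ ▸ fst_jointLaw hout
  have hpre (i) : enc ⁻¹' A i = Function.eval i ⁻¹' ({true} : Set Bool) :=
    Set.ext fun s => hencA s i
  have hind : iIndepSet A ρ.fst := by
    refine hfst ▸ iIndepSet_map henc hA ?_
    simp_rw [hpre]
    exact iIndepSet_pi fun _ => measurableSet_singleton _
  have hqA (i) : q.real (A i) = p := by
    rw [hq, map_measureReal_apply henc (hA i), hpre,
      (measurePreserving_eval _ i).measureReal_preimage
        (measurableSet_singleton true).nullMeasurableSet]
    exact bernoulliMeasure_real_apply_of_mem_of_notMem p (measurableSet_singleton true) rfl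
      Bool.false_ne_true
  have hqAc (i) : q.real (A i)ᶜ = 1 - p := by rw [probReal_compl_eq_one_sub (hA i), hqA]
  refine le_trans (ENNReal.ofReal_le_ofReal (le_of_eq (by ring))) <|
    card_mul_le_klDiv_of_iIndepSet ρ hA hS hind (p := p) (d₀ := 1 / 4) (d₁ := 3 / 4)
    (fun i => by rw [hfst, hqA]) p.2.1 p.2.2 (by norm_num) (by norm_num) (fun i => ?_) fun i => ?_
  · rw [hρ, ← hqA i]
    exact mul_real_le_jointLaw_map_real_prod henc hout (hA i) (hS i) fun s hs =>
      hhit s i ((hencA s i).1 hs)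
  · rw [hρ, ← hqAc i]
    exact jointLaw_map_real_prod_le_mul_real henc hout (hA i).compl (hS i) (by norm_num)
      fun s hs => hmiss s i (by simpa [hencA] using hs)

/-! ### Detection by averaging over the antennas -/

section Detection

variable {Ω : Type*} [MeasurableSpace Ω] {μ : Measure Ω} [IsProbabilityMeasure μ] {N : ℕ}
  {X : Ω → ℝ} {M d θ : ℝ}

lemma measureReal_pi_deviation_le (hX : MemLp X 2 μ) (hM : ∫ x, X x ^ 2 ∂μ ≤ M) (hN : 0 < N)
    (hd : 0 < d) (hNd : 4 * M ≤ N * d ^ 2) :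
    (Measure.pi fun _ : Fin N => μ).real {ω | N * d ≤ |∑ n, X (ω n) - N * ∫ x, X x ∂μ|} ≤
      1 / 4 := by
  have : (0 : ℝ) < N := Nat.cast_pos.2 hN
  set π := Measure.pi fun _ : Fin N => μ
  have hLp (n : Fin N) : MemLp (fun ω : Fin N → Ω => X (ω n)) 2 π :=
    hX.comp_measurePreserving (measurePreserving_eval (fun _ : Fin N => μ) n)
  have hmean : ∫ ω, (∑ n, fun ω : Fin N → Ω => X (ω n)) ω ∂π = N * ∫ x, X x ∂μ := by
    simp only [Finset.sum_apply]
    rw [integral_finsetSum _ fun n _ => (hLp n).integrable one_le_two]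
    simp_rw [π, integral_comp_eval (μ := fun _ : Fin N => μ) hX.aestronglyMeasurable]
    rw [Finset.sum_const, Finset.card_univ, Fintype.card_fin, nsmul_eq_mul]
  have hvar : variance (∑ n, fun ω : Fin N → Ω => X (ω n)) π ≤ N * M := by
    rw [variance_sum_pi (μ := fun _ : Fin N => μ) (X := fun _ => X) fun _ => hX,
      Finset.sum_const, Finset.card_univ, Fintype.card_fin, nsmul_eq_mul]
    gcongr
    exact (variance_le_expectation_sq hX.aestronglyMeasurable).trans hM
  have hchebyshev := meas_ge_le_variance_div_sq (memLp_finsetSum' Finset.univ fun n _ => hLp n)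
    (c := N * d) (by positivity)
  rw [hmean] at hchebyshev
  simp only [Finset.sum_apply] at hchebyshev
  refine ENNReal.toReal_le_of_le_ofReal (by norm_num)
    (hchebyshev.trans (ENNReal.ofReal_le_ofReal ?_))
  rw [div_le_iff₀ (by positivity)]
  nlinarith

lemma le_measureReal_pi_lt_sum (hX : MemLp X 2 μ) (hXm : Measurable X)
    (hM : ∫ x, X x ^ 2 ∂μ ≤ M) (hN : 0 < N) (hd : 0 < d) (hNd : 4 * M ≤ N * d ^ 2)
    (hθ : θ + d ≤ ∫ x, X x ∂μ) :
    3 / 4 ≤ (Measure.pi fun _ : Fin N => μ).real {ω | N * θ < ∑ n, X (ω n)} := by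
  have hmeas : MeasurableSet {ω : Fin N → Ω | N * θ < ∑ n, X (ω n)} :=
    measurableSet_lt measurable_const (by fun_prop)
  have hsub : {ω : Fin N → Ω | N * θ < ∑ n, X (ω n)}ᶜ ⊆
      {ω | N * d ≤ |∑ n, X (ω n) - N * ∫ x, X x ∂μ|} := by
    intro ω hω
    simp only [Set.mem_compl_iff, Set.mem_ofPred_eq, not_lt] at hω ⊢
    refine le_trans ?_ (neg_le_abs _)
    linarith [mul_le_mul_of_nonneg_left hθ N.cast_nonneg]
  have hcompl := (measureReal_mono hsub).trans (measureReal_pi_deviation_le hX hM hN hd hNd)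
  rw [probReal_compl_eq_one_sub hmeas] at hcompl
  linarith

lemma measureReal_pi_lt_sum_le (hX : MemLp X 2 μ) (hM : ∫ x, X x ^ 2 ∂μ ≤ M) (hN : 0 < N)
    (hd : 0 < d) (hNd : 4 * M ≤ N * d ^ 2) (hθ : ∫ x, X x ∂μ ≤ θ - d) :
    (Measure.pi fun _ : Fin N => μ).real {ω | N * θ < ∑ n, X (ω n)} ≤ 1 / 4 := by
  refine (measureReal_mono fun ω hω => ?_).trans (measureReal_pi_deviation_le hX hM hN hd hNd)
  simp only [Set.mem_ofPred_eq] at hω ⊢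
  refine le_trans ?_ (le_abs_self _)
  linarith [mul_le_mul_of_nonneg_left hθ N.cast_nonneg]

end Detection

lemma measurePreserving_rows {B : ℕ} (N L : ℕ) (b : Fin B) :
    MeasurePreserving (fun (p : Fading B N × Output B N L) n => (p.1 b n, p.2 b n))
      ((fadingLaw B N).prod (noiseLaw B N L)) (Measure.pi fun _ : Fin N => rowLaw L) :=
  (measurePreserving_arrowProdEquivProdArrow ℂ (Fin L → ℂ) (Fin N)
    (fun _ => stdComplexGaussian) fun _ => Measure.pi fun _ => stdComplexGaussian).symm.comp
  ((measurePreserving_eval (fun _ : Fin B => Measure.pi fun _ : Fin N => stdComplexGaussian) b).prod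
    (measurePreserving_eval (fun _ : Fin B => Measure.pi fun _ : Fin N =>
      Measure.pi fun _ : Fin L => stdComplexGaussian) b))

lemma measureReal_lt_sum_rows {B N L : ℕ} (b : Fin B) {X : ℂ × (Fin L → ℂ) → ℝ}
    (hX : Measurable X) (t : ℝ) :
    ((fadingLaw B N).prod (noiseLaw B N L)).real {p | t < ∑ n, X (p.1 b n, p.2 b n)} =
      (Measure.pi fun _ : Fin N => rowLaw L).real {ω | t < ∑ n, X (ω n)} := by
  have hmeas : MeasurableSet {ω : Fin N → ℂ × (Fin L → ℂ) | t < ∑ n, X (ω n)} :=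
    measurableSet_lt measurable_const (by fun_prop)
  exact (measurePreserving_rows N L b).measureReal_preimage hmeas.nullMeasurableSet

/-! ### Moments of the received symbols -/

section ReceivedSymbol

variable {L : ℕ}

/-- The symbol one antenna receives in slot `l` when `x` is sent, as a function of its fading
coefficient and noise. -/
def receivedSymbol (x : ℂ) (l : Fin L) (r : ℂ × (Fin L → ℂ)) : ℂ := r.1 * star x + r.2 l

@[fun_prop]
lemma measurable_receivedSymbol (x : ℂ) (l : Fin L) : Measurable (receivedSymbol x l) := by
  unfold receivedSymbol
  fun_prop

lemma receivedSymbol_eq_sum (x : ℂ) (l : Fin L) :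
    receivedSymbol x l = fun r => star x * r.1 + ∑ m, (Pi.single l 1 : Fin L → ℂ) m * r.2 m := by
  ext r
  simp [receivedSymbol, Pi.single_apply, mul_comm]

lemma memLp_receivedSymbol (x : ℂ) (l : Fin L) (p : ℝ≥0) :
    MemLp (receivedSymbol x l) p (rowLaw L) := by
  rw [receivedSymbol_eq_sum]
  exact memLp_rowLaw _ _ p

lemma integral_norm_sq_receivedSymbol (x : ℂ) (l : Fin L) :
    ∫ r, ‖receivedSymbol x l r‖ ^ 2 ∂rowLaw L = ‖x‖ ^ 2 + 1 := by
  rw [receivedSymbol_eq_sum, integral_norm_sq_rowLaw, norm_star]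
  simp [Pi.single_apply, apply_ite (‖·‖ : ℂ → ℝ), ite_pow]

lemma integral_star_mul_receivedSymbol (x y : ℂ) {l m : Fin L} (hlm : l ≠ m) :
    ∫ r, star (receivedSymbol x l r) * receivedSymbol y m r ∂rowLaw L = x * star y := by
  rw [receivedSymbol_eq_sum, receivedSymbol_eq_sum, integral_star_mul_rowLaw, star_star]
  simp [Pi.single_apply, hlm.symm]

/-- A common bound for the fourth moments of the symbols received when at most unit energy is
sent. -/
def fourthMomentBound : ℝ := 16 * ∫ z, ‖z‖ ^ 4 ∂stdComplexGaussian + 1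

lemma fourthMomentBound_pos : 0 < fourthMomentBound := by
  unfold fourthMomentBound
  positivity

lemma integrable_norm_pow_four_receivedSymbol (x : ℂ) (l : Fin L) :
    Integrable (fun r => ‖receivedSymbol x l r‖ ^ 4) (rowLaw L) :=
  (memLp_receivedSymbol x l 4).integrable_norm_pow' (p := 4)

lemma integral_norm_pow_four_receivedSymbol_le {x : ℂ} (hx : ‖x‖ ≤ 1) (l : Fin L) :
    ∫ r, ‖receivedSymbol x l r‖ ^ 4 ∂rowLaw L ≤ fourthMomentBound := by
  have hpointwise (r : ℂ × (Fin L → ℂ)) :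
      ‖receivedSymbol x l r‖ ^ 4 ≤ 8 * (‖r.1‖ ^ 4 + ‖r.2 l‖ ^ 4) := by
    have htriangle : ‖receivedSymbol x l r‖ ≤ ‖r.1‖ + ‖r.2 l‖ := by
      refine (norm_add_le _ _).trans ?_
      rw [norm_mul, norm_star]
      gcongr
      exact mul_le_of_le_one_right (norm_nonneg _) hx
    have hpow := add_pow_le (norm_nonneg r.1) (norm_nonneg (r.2 l)) 4
    norm_num at hpow
    exact (pow_le_pow_left₀ (norm_nonneg _) htriangle 4).trans hpow
  have hint (k : Option (Fin L)) :
      Integrable (fun r : ℂ × (Fin L → ℂ) => ‖(k.elim r.1 r.2 : ℂ)‖ ^ 4) (rowLaw L) :=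
    (memLp_elim_rowLaw k 4).integrable_norm_pow' (p := 4)
  have hval (k : Option (Fin L)) : ∫ r, ‖(k.elim r.1 r.2 : ℂ)‖ ^ 4 ∂rowLaw L =
      ∫ z, ‖z‖ ^ 4 ∂stdComplexGaussian := by
    have hmap := measurePreserving_elim_rowLaw k
    rw [← hmap.map_eq]
    exact (integral_map (f := fun z => ‖z‖ ^ 4) hmap.aemeasurable (by fun_prop)).symm
  calc ∫ r, ‖receivedSymbol x l r‖ ^ 4 ∂rowLaw L
      ≤ ∫ r, 8 * (‖r.1‖ ^ 4 + ‖r.2 l‖ ^ 4) ∂rowLaw L :=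
        integral_mono (integrable_norm_pow_four_receivedSymbol x l)
          (((hint none).add (hint (some l))).const_mul 8) hpointwise
    _ = 8 * (∫ z, ‖z‖ ^ 4 ∂stdComplexGaussian + ∫ z, ‖z‖ ^ 4 ∂stdComplexGaussian) := by
        rw [integral_const_mul]
        exact congrArg (8 * ·) ((integral_add (hint none) (hint (some l))).trans
          (congrArg₂ (· + ·) (hval none) (hval (some l))))
    _ ≤ fourthMomentBound := by
        rw [fourthMomentBound]
        linarith

lemma memLp_norm_sq_receivedSymbol (x : ℂ) (l : Fin L) :
    MemLp (fun r => ‖receivedSymbol x l r‖ ^ 2) 2 (rowLaw L) := by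
  rw [memLp_two_iff_integrable_sq (by fun_prop)]
  simpa only [← pow_mul] using integrable_norm_pow_four_receivedSymbol x l

lemma re_star_mul_sq_le (w v : ℂ) : (star w * v).re ^ 2 ≤ (‖w‖ ^ 4 + ‖v‖ ^ 4) / 2 := by
  have hre := pow_le_pow_left₀ (abs_nonneg _) (Complex.abs_re_le_norm (star w * v)) 2
  rw [sq_abs, norm_mul, norm_star] at hre
  nlinarith [sq_nonneg (‖w‖ ^ 2 - ‖v‖ ^ 2)]

lemma memLp_re_star_mul_receivedSymbol (x y : ℂ) (l m : Fin L) :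
    MemLp (fun r => (star (receivedSymbol x l r) * receivedSymbol y m r).re) 2 (rowLaw L) := by
  rw [memLp_two_iff_integrable_sq (by fun_prop)]
  refine (((integrable_norm_pow_four_receivedSymbol x l).add
    (integrable_norm_pow_four_receivedSymbol y m)).div_const 2).mono' (by fun_prop)
    (ae_of_all _ fun r => ?_)
  rw [Real.norm_of_nonneg (sq_nonneg _)]
  exact re_star_mul_sq_le _ _

lemma integral_re_star_mul_sq_receivedSymbol_le {x y : ℂ} (hx : ‖x‖ ≤ 1) (hy : ‖y‖ ≤ 1)
    (l m : Fin L) :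
    ∫ r, (star (receivedSymbol x l r) * receivedSymbol y m r).re ^ 2 ∂rowLaw L ≤
      fourthMomentBound := by
  have hintx := integrable_norm_pow_four_receivedSymbol x l
  have hinty := integrable_norm_pow_four_receivedSymbol y m
  refine (integral_mono (memLp_re_star_mul_receivedSymbol x y l m).integrable_sq
    ((hintx.add hinty).div_const 2) fun r => re_star_mul_sq_le _ _).trans ?_
  rw [integral_div, integral_add' hintx hinty]
  linarith [integral_norm_pow_four_receivedSymbol_le hx l,
    integral_norm_pow_four_receivedSymbol_le hy m]

lemma integral_re_star_mul_receivedSymbol (x y : ℂ) {l m : Fin L} (hlm : l ≠ m) :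
    ∫ r, (star (receivedSymbol x l r) * receivedSymbol y m r).re ∂rowLaw L =
      (x * star y).re := by
  rw [← integral_star_mul_receivedSymbol x y hlm]
  have hmem (z : ℂ) (k : Fin L) : MemLp (receivedSymbol z k) 2 (rowLaw L) :=
    memLp_receivedSymbol z k 2
  exact integral_re ((hmem x l).star.integrable_mul (hmem y m))

end ReceivedSymbol

/-! ### On–off energy modulation -/

lemma ofReal_le_mutualInfo_div {α β : Type*} [MeasurableSpace α] [MeasurableSpace β]
    {ρ : Measure (α × β)} {c Δf : ℝ} {L : ℕ} (hΔf : 0 < Δf) (hL : 0 < L)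
    (h : ENNReal.ofReal c ≤ klDiv ρ (ρ.fst.prod ρ.snd)) :
    ENNReal.ofReal (c / Real.log 2 / (L / Δf)) ≤
      mutualInfo ρ / ((L : ℝ≥0∞) / ENNReal.ofReal Δf) := by
  rw [ENNReal.ofReal_div_of_pos (div_pos (Nat.cast_pos.2 hL) hΔf),
    ENNReal.ofReal_div_of_pos (Real.log_pos one_lt_two), ENNReal.ofReal_div_of_pos hΔf,
    ENNReal.ofReal_natCast, mutualInfo]
  gcongr

section OnOff

variable {B N L : ℕ} {P Δf A : ℝ} {p : unitInterval}

/-- On–off energy modulation: subcarrier `b` carries energy `A` if `s b` and none otherwise. -/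
def onOffEnergy (A : ℝ) (s : Fin B → Bool) (b : Fin B) : ℝ := if s b then A else 0

/-- The law of on–off energies when each subcarrier is active independently with probability
`p`. -/
def onOffLaw (B : ℕ) (p : unitInterval) (A : ℝ) : Measure (Fin B → ℝ) :=
  (Measure.pi fun _ => bernoulliMeasure true false p).map (onOffEnergy A)

instance : IsProbabilityMeasure (onOffLaw B p A) :=
  Measure.isProbabilityMeasure_map (measurable_of_countable _).aemeasurable

/-- The shape that concentrates the energy of every subcarrier in slot `l`. -/
def slotShape (B : ℕ) (l : Fin L) : Input B L := fun _ => EuclideanSpace.single l 1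

lemma onOffEnergy_nonneg (hA : 0 ≤ A) (s : Fin B → Bool) (b : Fin B) : 0 ≤ onOffEnergy A s b := by
  unfold onOffEnergy
  split_ifs
  exacts [hA, le_rfl]

lemma ae_onOffLaw_nonneg (hA : 0 ≤ A) : ∀ᵐ a ∂onOffLaw B p A, ∀ b, 0 ≤ a b := by
  have hmeas : MeasurableSet {a : Fin B → ℝ | ∀ b, 0 ≤ a b} := measurableSet_Ici
  exact (ae_map_iff (measurable_of_countable _).aemeasurable hmeas).2
    (ae_of_all _ (onOffEnergy_nonneg hA))

lemma lintegral_onOffLaw (hA : 0 ≤ A) (b : Fin B) :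
    ∫⁻ a, ENNReal.ofReal (a b) ∂onOffLaw B p A = ENNReal.ofReal (p * A) := by
  rw [onOffLaw, lintegral_map (by fun_prop) (measurable_of_countable _)]
  have heval := (measurePreserving_eval (fun _ : Fin B => bernoulliMeasure true false p) b)
    |>.lintegral_comp (f := fun s => ENNReal.ofReal (if s then A else 0))
      (measurable_of_countable _)
  refine heval.trans ?_
  rw [← ofReal_integral_eq_lintegral_ofReal (integrable_bernoulliMeasure _ _ _ _)
    (ae_of_all _ fun s => by positivity), integral_bernoulliMeasure]
  simp

lemma isOEDInput_onOffLaw (hA : 0 ≤ A) (l : Fin L) (hpow : B * ((p : ℝ) * A) ≤ P * L) :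
    IsOEDInput P (onOffLaw B p A) (Measure.dirac (slotShape B l)) := by
  have hshape : ∀ᵐ u ∂Measure.dirac (slotShape B l), ∀ b, ‖u b‖ = 1 := by
    rw [ae_dirac_eq]
    intro b
    simp [slotShape]
  refine ⟨inferInstance, inferInstance, ae_onOffLaw_nonneg hA, hshape, ?_⟩
  have hL : (0 : ℝ) < L := Nat.cast_pos.2 l.pos
  rw [avgPower_map_energyShape (ae_onOffLaw_nonneg hA) hshape]
  simp_rw [lintegral_onOffLaw hA]
  rw [Finset.sum_const, Finset.card_univ, Fintype.card_fin, nsmul_eq_mul,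
    ← ENNReal.ofReal_natCast B, ← ENNReal.ofReal_natCast L, ← ENNReal.ofReal_mul B.cast_nonneg,
    ← ENNReal.ofReal_div_of_pos hL]
  exact ENNReal.ofReal_le_ofReal ((div_le_iff₀ hL).2 hpow)

lemma energyOutputLaw_dirac (N : ℕ) (pa : Measure (Fin B → ℝ)) [SFinite pa] (u : Input B L) :
    energyOutputLaw N pa (Measure.dirac u) = jointLaw pa ((fadingLaw B N).prod (noiseLaw B N L))
      fun a k => channelOutput (energyShape a u) k.1 k.2 := by
  have hprod := Measure.map_prod_map pa ((fadingLaw B N).prod (noiseLaw B N L))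
    (measurable_prodMk_right (y := u)) measurable_id
  rw [Measure.map_id] at hprod
  rw [energyOutputLaw, Measure.prod_dirac, hprod, Measure.map_map (by fun_prop) (by fun_prop)]
  rfl

lemma channelOutput_onOff (s : Fin B → Bool) (l : Fin L) (h : Fading B N) (z : Output B N L)
    (b : Fin B) (n : Fin N) :
    channelOutput (energyShape (onOffEnergy A s) (slotShape B l)) h z b n l =
      receivedSymbol (√(onOffEnergy A s b) : ℝ) l (h b n, z b n) := by
  simp [channelOutput, receivedSymbol, energyShape, slotShape]

/-- The smallest on–energy that averaging over `N` antennas detects reliably. -/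
def onEnergy (N : ℕ) : ℝ := 4 * √(fourthMomentBound / N)

lemma onEnergy_pos (hN : 0 < N) : 0 < onEnergy N := by
  have := fourthMomentBound_pos
  have : (0 : ℝ) < N := Nat.cast_pos.2 hN
  unfold onEnergy
  positivity

lemma onEnergy_sq (N : ℕ) : onEnergy N ^ 2 = 16 * fourthMomentBound / N := by
  rw [onEnergy, mul_pow, Real.sq_sqrt (div_nonneg fourthMomentBound_pos.le N.cast_nonneg)]
  ring

lemma integral_onOff_statistic (hA : 0 ≤ A) (l : Fin L) :
    ∫ r, ‖receivedSymbol (√A : ℝ) l r‖ ^ 2 ∂rowLaw L = A + 1 := by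
  rw [integral_norm_sq_receivedSymbol, Complex.norm_real, Real.norm_eq_abs, sq_abs,
    Real.sq_sqrt hA]

lemma integral_onOff_statistic_sq_le (hA : A ≤ 1) (l : Fin L) :
    ∫ r, (‖receivedSymbol (√A : ℝ) l r‖ ^ 2) ^ 2 ∂rowLaw L ≤ fourthMomentBound := by
  simp_rw [← pow_mul]
  refine integral_norm_pow_four_receivedSymbol_le ?_ l
  rw [Complex.norm_real, Real.norm_of_nonneg (Real.sqrt_nonneg _)]
  exact Real.sqrt_le_one.2 hA

lemma ofReal_le_klDiv_onOff (p : unitInterval) (hN : 16 * fourthMomentBound ≤ N) (l : Fin L) :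
    let ρ := energyOutputLaw N (onOffLaw B p (onEnergy N)) (Measure.dirac (slotShape B l))
    ENNReal.ofReal (B * (p * (1 - p)) / 16) ≤ klDiv ρ (ρ.fst.prod ρ.snd) := by
  have hN' : (0 : ℝ) < N := by linarith [fourthMomentBound_pos]
  have hA := onEnergy_pos (Nat.cast_pos.1 hN')
  have hA1 : onEnergy N ≤ 1 := by
    rw [← sq_le_one_iff₀ hA.le, onEnergy_sq]
    exact (div_le_one hN').2 hN
  have hdev : 4 * fourthMomentBound ≤ N * (onEnergy N / 2) ^ 2 := by
    rw [div_pow, onEnergy_sq]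
    field_simp
    linarith
  have hinfo := card_mul_le_klDiv_jointLaw_of_bits p ((fadingLaw B N).prod (noiseLaw B N L))
    (enc := onOffEnergy (onEnergy N)) (A := fun b => {a | 0 < a b})
    (out := fun a k => channelOutput (energyShape a (slotShape B l)) k.1 k.2)
    (S := fun b => {y | N * (1 + onEnergy N / 2) < ∑ n, ‖y b n l‖ ^ 2}) (by fun_prop)
    (fun b => measurableSet_lt measurable_const (measurable_pi_apply b))
    (fun s b => by cases hs : s b <;> simp [onOffEnergy, hs, hA])
    (fun b => measurableSet_lt measurable_const (by fun_prop)) (fun s b hs => ?_)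
    (fun s b hs => ?_) (energyOutputLaw_dirac N _ _)
  · rwa [Fintype.card_fin] at hinfo
  · have hon : onOffEnergy (onEnergy N) s b = onEnergy N := if_pos hs
    simp only [Set.mem_ofPred_eq, channelOutput_onOff, hon]
    rw [measureReal_lt_sum_rows b (X := fun r => ‖receivedSymbol (√(onEnergy N) : ℝ) l r‖ ^ 2)
      (by fun_prop)]
    refine le_measureReal_pi_lt_sum (memLp_norm_sq_receivedSymbol _ _) (by fun_prop)
      (integral_onOff_statistic_sq_le hA1 l) (Nat.cast_pos.1 hN') (half_pos hA) hdev ?_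
    rw [integral_onOff_statistic hA.le]
    linarith
  · have hoff : onOffEnergy (onEnergy N) s b = 0 := if_neg (by simp [hs])
    simp only [Set.mem_ofPred_eq, channelOutput_onOff, hoff]
    rw [measureReal_lt_sum_rows b (X := fun r => ‖receivedSymbol (√0 : ℝ) l r‖ ^ 2)
      (by fun_prop)]
    refine measureReal_pi_lt_sum_le (memLp_norm_sq_receivedSymbol _ _)
      (integral_onOff_statistic_sq_le zero_le_one l) (Nat.cast_pos.1 hN') (half_pos hA) hdev ?_
    rw [integral_onOff_statistic le_rfl]
    linarith

lemma le_oedCapacity (hΔf : 0 < Δf) (hL : 0 < L) (hN : 16 * fourthMomentBound ≤ N)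
    (hpow : B * ((p : ℝ) * onEnergy N) ≤ P * L) :
    ENNReal.ofReal (B * (p * (1 - p)) / 16 / Real.log 2 / (L / Δf)) ≤ oedCapacity P Δf B N L := by
  have hN' : (0 : ℝ) < N := by linarith [fourthMomentBound_pos]
  have hinput := isOEDInput_onOffLaw (onEnergy_pos (Nat.cast_pos.1 hN')).le ⟨0, hL⟩ hpow
  exact (ofReal_le_mutualInfo_div hΔf hL (ofReal_le_klDiv_onOff p hN ⟨0, hL⟩)).trans
    (le_iSup_of_le _ (le_iSup_of_le _ (le_iSup_of_le hinput le_rfl)))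

end OnOff

/-! ### Pilot-aided antipodal signalling -/

section Pilot

variable {B L S : ℕ} {P Δf A r : ℝ}

/-- The antipodal symbol of a bit. -/
def antipodal (s : Bool) : ℝ := if s then 1 else -1

lemma antipodal_sq (s : Bool) : antipodal s ^ 2 = 1 := by
  cases s <;> norm_num [antipodal]

/-- A block of length `L + 1`: a pilot of energy `A` in slot `0`, then one antipodal symbol of
energy `r` per bit. -/
def pilotBlock (A r : ℝ) (c : Fin L → Bool) : EuclideanSpace ℂ (Fin (L + 1)) :=
  WithLp.toLp 2 (Fin.cons ((√A : ℝ) : ℂ) fun k => ((√r * antipodal (c k) : ℝ) : ℂ))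

/-- The encoder that sends pilot blocks on the first `S` subcarriers and nothing on the rest. -/
def pilotCode (A r : ℝ) (s : Fin S × Fin L → Bool) : Input B (L + 1) :=
  fun b => if h : b.val < S then pilotBlock A r (fun k => s (⟨b, h⟩, k)) else 0

/-- The probability of a fair bit. -/
def fair : unitInterval := ⟨1 / 2, by norm_num, by norm_num⟩

/-- The law of pilot-aided antipodal signalling with independent uniform bits. -/
def pilotLaw (B L S : ℕ) (A r : ℝ) : Measure (Input B (L + 1)) :=
  (Measure.pi fun _ : Fin S × Fin L => bernoulliMeasure true false fair).map
    (pilotCode A r)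

lemma pilotBlock_zero (c : Fin L → Bool) : pilotBlock A r c 0 = (√A : ℝ) := rfl

lemma pilotBlock_succ (c : Fin L → Bool) (k : Fin L) :
    pilotBlock A r c k.succ = (√r * antipodal (c k) : ℝ) := rfl

lemma norm_pilotBlock_sq (hA : 0 ≤ A) (hr : 0 ≤ r) (c : Fin L → Bool) :
    ‖pilotBlock A r c‖ ^ 2 = A + L * r := by
  simp [EuclideanSpace.norm_sq_eq, Fin.sum_univ_succ, pilotBlock_zero, pilotBlock_succ, -map_mul,
    -Complex.ofReal_mul, Complex.norm_real, mul_pow, antipodal_sq, Real.sq_sqrt, hA, hr]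

lemma pilotCode_castLE (hS : S ≤ B) (s : Fin S × Fin L → Bool) (b : Fin S) :
    pilotCode A r s (b.castLE hS) = pilotBlock A r fun k => s (b, k) :=
  dif_pos b.2

lemma sum_norm_pilotCode_sq (hS : S ≤ B) (hA : 0 ≤ A) (hr : 0 ≤ r) (s : Fin S × Fin L → Bool) :
    ∑ b : Fin B, ‖pilotCode A r s b‖ ^ 2 = S * (A + L * r) := by
  have hblock (b : Fin B) :
      ‖pilotCode A r s b‖ ^ 2 = if b.val < S then A + L * r else 0 := by
    rw [pilotCode]
    split_ifs
    · exact norm_pilotBlock_sq hA hr _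
    · simp
  simp_rw [hblock]
  rw [← Finset.sum_filter, Finset.sum_const, Fin.card_filter_val_lt, min_eq_right hS,
    nsmul_eq_mul]

lemma isInput_pilotLaw (hS : S ≤ B) (hA : 0 ≤ A) (hr : 0 ≤ r)
    (hpow : S * (A + L * r) ≤ P * (L + 1 : ℕ)) : IsInput P (pilotLaw B L S A r) := by
  have hL : (0 : ℝ) < (L + 1 : ℕ) := by positivity
  refine ⟨Measure.isProbabilityMeasure_map (measurable_of_countable _).aemeasurable, ?_⟩
  rw [avgPower, pilotLaw, lintegral_map (by fun_prop) (measurable_of_countable _)]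
  simp_rw [sum_enorm_sq, ← ENNReal.ofReal_sum_of_nonneg fun _ _ => sq_nonneg _,
    sum_norm_pilotCode_sq hS hA hr]
  rw [lintegral_const, measure_univ, mul_one, ← ENNReal.ofReal_natCast,
    ← ENNReal.ofReal_div_of_pos hL]
  exact ENNReal.ofReal_le_ofReal ((div_le_iff₀ hL).2 hpow)

lemma channelOutput_pilot (hS : S ≤ B) (s : Fin S × Fin L → Bool) {N : ℕ} (h : Fading B N)
    (z : Output B N (L + 1)) (b : Fin S) (n : Fin N) :
    channelOutput (pilotCode A r s) h z (b.castLE hS) n 0 =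
      receivedSymbol (√A : ℝ) 0 (h (b.castLE hS) n, z (b.castLE hS) n) := by
  rw [← pilotBlock_zero (r := r) fun k => s (b, k), ← pilotCode_castLE hS]
  rfl

lemma channelOutput_antipodal (hS : S ≤ B) (s : Fin S × Fin L → Bool) {N : ℕ} (h : Fading B N)
    (z : Output B N (L + 1)) (b : Fin S) (k : Fin L) (n : Fin N) :
    channelOutput (pilotCode A r s) h z (b.castLE hS) n k.succ =
      receivedSymbol (√r * antipodal (s (b, k)) : ℝ) k.succ
        (h (b.castLE hS) n, z (b.castLE hS) n) := by
  rw [← pilotBlock_succ (A := A) fun k => s (b, k), ← pilotCode_castLE hS]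
  rfl

lemma integral_pilot_statistic (A r : ℝ) (s : Bool) (k : Fin L) :
    ∫ q, (star (receivedSymbol (√A : ℝ) 0 q) *
        receivedSymbol (√r * antipodal s : ℝ) k.succ q).re ∂rowLaw (L + 1) =
      √A * √r * antipodal s := by
  rw [integral_re_star_mul_receivedSymbol _ _ (Fin.succ_ne_zero k).symm, Complex.star_def,
    Complex.conj_ofReal, ← Complex.ofReal_mul, Complex.ofReal_re, mul_assoc]

lemma integral_pilot_statistic_sq_le (hA : A ≤ 1) (hr : r ≤ 1) (s : Bool) (k : Fin L) :
    ∫ q, (star (receivedSymbol (√A : ℝ) 0 q) *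
        receivedSymbol (√r * antipodal s : ℝ) k.succ q).re ^ 2 ∂rowLaw (L + 1) ≤
      fourthMomentBound := by
  have hsqrt {x : ℝ} (hx : x ≤ 1) : ‖√x‖ ≤ 1 := by
    rw [Real.norm_of_nonneg (Real.sqrt_nonneg x)]
    exact Real.sqrt_le_one.2 hx
  refine integral_re_star_mul_sq_receivedSymbol_le ?_ ?_ _ _
  · exact (Complex.norm_real _).trans_le (hsqrt hA)
  · rw [Complex.norm_real, norm_mul]
    cases s <;> simpa [antipodal] using hsqrt hr

lemma ofReal_le_klDiv_pilot {N : ℕ} (hS : S ≤ B) (hN : 0 < N) (hA : 0 < A) (hA1 : A ≤ 1)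
    (hr : 0 < r) (hr1 : r ≤ 1) (hsnr : 4 * fourthMomentBound ≤ N * (A * r)) :
    let ρ := inputOutputLaw N (pilotLaw B L S A r)
    ENNReal.ofReal (S * L / 64) ≤ klDiv ρ (ρ.fst.prod ρ.snd) := by
  have hdev : 4 * fourthMomentBound ≤ N * (√A * √r) ^ 2 := by
    rwa [mul_pow, Real.sq_sqrt hA.le, Real.sq_sqrt hr.le]
  have hmean : 0 < √A * √r := by positivity
  have hinfo := card_mul_le_klDiv_jointLaw_of_bits (ι := Fin S × Fin L) fair
    ((fadingLaw B N).prod (noiseLaw B N (L + 1)))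
    (enc := pilotCode A r) (A := fun i => {x | 0 < (x (i.1.castLE hS) i.2.succ).re})
    (out := fun x k => channelOutput x k.1 k.2)
    (S := fun i => {y | N * (0 : ℝ) <
      ∑ n, (star (y (i.1.castLE hS) n 0) * y (i.1.castLE hS) n i.2.succ).re}) (by fun_prop)
    (fun i => measurableSet_lt measurable_const (by fun_prop)) (fun s i => ?_)
    (fun i => measurableSet_lt measurable_const (by fun_prop)) (fun s i hs => ?_)
    (fun s i hs => ?_) (ρ := inputOutputLaw N (pilotLaw B L S A r)) rfl
  · refine le_of_eq_of_le ?_ hinfo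
    rw [Fintype.card_prod, Fintype.card_fin, Fintype.card_fin]
    congr 1
    simp only [Nat.cast_mul, fair]
    ring
  · have := Real.sqrt_pos.2 hr
    simp only [Set.mem_ofPred_eq, pilotCode_castLE, pilotBlock_succ, Complex.ofReal_re]
    cases hs : s i <;> simp [antipodal, this, this.le]
  · simp only [Set.mem_ofPred_eq, channelOutput_pilot, channelOutput_antipodal, hs]
    rw [measureReal_lt_sum_rows (i.1.castLE hS) (X := fun q =>
      (star (receivedSymbol (√A : ℝ) 0 q) *
        receivedSymbol (√r * antipodal true : ℝ) i.2.succ q).re) (by fun_prop)]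
    refine le_measureReal_pi_lt_sum (memLp_re_star_mul_receivedSymbol _ _ _ _) (by fun_prop)
      (integral_pilot_statistic_sq_le hA1 hr1 _ _) hN hmean hdev ?_
    rw [integral_pilot_statistic]
    simp [antipodal]
  · simp only [Set.mem_ofPred_eq, channelOutput_pilot, channelOutput_antipodal, hs]
    rw [measureReal_lt_sum_rows (i.1.castLE hS) (X := fun q =>
      (star (receivedSymbol (√A : ℝ) 0 q) *
        receivedSymbol (√r * antipodal false : ℝ) i.2.succ q).re) (by fun_prop)]
    refine measureReal_pi_lt_sum_le (memLp_re_star_mul_receivedSymbol _ _ _ _)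
      (integral_pilot_statistic_sq_le hA1 hr1 _ _) hN hmean hdev ?_
    rw [integral_pilot_statistic]
    simp [antipodal]

lemma le_nonCoherentCapacity {N : ℕ} (hΔf : 0 < Δf) (hS : S ≤ B) (hN : 0 < N) (hA : 0 < A)
    (hA1 : A ≤ 1) (hr : 0 < r) (hr1 : r ≤ 1) (hsnr : 4 * fourthMomentBound ≤ N * (A * r))
    (hpow : S * (A + L * r) ≤ P * (L + 1 : ℕ)) :
    ENNReal.ofReal (S * L / 64 / Real.log 2 / ((L + 1 : ℕ) / Δf)) ≤
      nonCoherentCapacity P Δf B N (L + 1) :=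
  (ofReal_le_mutualInfo_div hΔf L.succ_pos
    (ofReal_le_klDiv_pilot hS hN hA hA1 hr hr1 hsnr)).trans
    (le_iSup_of_le _ (le_iSup_of_le (isInput_pilotLaw hS hA.le hr.le hpow) le_rfl))

end Pilot

/-! ### Calculus of scaling exponents -/

/-- The counterpart of `HasScalingExponent` for real sequences: `f` is eventually positive and
`log f(N) / log N → e`. -/
def HasExponent (f : ℕ → ℝ) (e : ℝ) : Prop :=
  (∀ᶠ N in atTop, 0 < f N) ∧ Tendsto (fun N : ℕ => Real.log (f N) / Real.log N) atTop (𝓝 e)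

lemma tendsto_log_natCast_atTop : Tendsto (fun N : ℕ => Real.log N) atTop atTop :=
  Real.tendsto_log_atTop.comp tendsto_natCast_atTop_atTop

lemma eventually_log_natCast_pos : ∀ᶠ N : ℕ in atTop, 0 < Real.log N :=
  tendsto_log_natCast_atTop.eventually_gt_atTop 0

lemma hasExponent_const {c : ℝ} (hc : 0 < c) : HasExponent (fun _ => c) 0 :=
  ⟨Eventually.of_forall fun _ => hc, tendsto_log_natCast_atTop.const_div_atTop _⟩

lemma hasExponent_rpow (e : ℝ) : HasExponent (fun N => (N : ℝ) ^ e) e := by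
  have hpos : ∀ᶠ N : ℕ in atTop, (0 : ℝ) < N :=
    tendsto_natCast_atTop_atTop.eventually_gt_atTop 0
  refine ⟨hpos.mono fun N hN => Real.rpow_pos_of_pos hN e, tendsto_const_nhds.congr' ?_⟩
  filter_upwards [hpos, eventually_log_natCast_pos] with N hN hlog
  rw [Real.log_rpow hN, mul_div_cancel_right₀ _ hlog.ne']

lemma hasExponent_natCast : HasExponent (fun N => (N : ℝ)) 1 := by
  simpa only [Real.rpow_one] using hasExponent_rpow 1

lemma hasExponent_log_natCast : HasExponent (fun N => Real.log N) 0 :=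
  ⟨eventually_log_natCast_pos,
    Real.isLittleO_log_id_atTop.tendsto_div_nhds_zero.comp tendsto_log_natCast_atTop⟩

namespace HasExponent

variable {f g h : ℕ → ℝ} {a b : ℝ}

lemma congr_exponent (hf : HasExponent f a) (hab : a = b) : HasExponent f b :=
  hab ▸ hf

protected lemma mul (hf : HasExponent f a) (hg : HasExponent g b) :
    HasExponent (fun N => f N * g N) (a + b) := by
  refine ⟨hf.1.mp (hg.1.mono fun N hgN hfN => mul_pos hfN hgN), (hf.2.add hg.2).congr' ?_⟩
  filter_upwards [hf.1, hg.1] with N hfN hgN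
  rw [Real.log_mul hfN.ne' hgN.ne', add_div]

protected lemma inv (hf : HasExponent f a) : HasExponent (fun N => (f N)⁻¹) (-a) := by
  refine ⟨hf.1.mono fun N => inv_pos.2, hf.2.neg.congr fun N => ?_⟩
  rw [Real.log_inv, neg_div]

protected lemma div (hf : HasExponent f a) (hg : HasExponent g b) :
    HasExponent (fun N => f N / g N) (a - b) := by
  simpa only [div_eq_mul_inv, sub_eq_add_neg] using hf.mul hg.inv

lemma const_mul (hf : HasExponent f a) {c : ℝ} (hc : 0 < c) :
    HasExponent (fun N => c * f N) a := by
  simpa only [zero_add] using (hasExponent_const hc).mul hf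

lemma div_const (hf : HasExponent f a) {c : ℝ} (hc : 0 < c) :
    HasExponent (fun N => f N / c) a := by
  simpa only [sub_zero] using hf.div (hasExponent_const hc)

protected lemma sqrt (hf : HasExponent f a) : HasExponent (fun N => √(f N)) (a / 2) := by
  refine ⟨hf.1.mono fun N => Real.sqrt_pos.2, (hf.2.div_const 2).congr' ?_⟩
  filter_upwards [hf.1] with N hN
  rw [Real.log_sqrt hN.le, div_right_comm]

protected lemma min (hf : HasExponent f a) (hg : HasExponent g b) :
    HasExponent (fun N => min (f N) (g N)) (min a b) := by
  refine ⟨hf.1.mp (hg.1.mono fun N hgN hfN => lt_min hfN hgN), (hf.2.min hg.2).congr' ?_⟩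
  filter_upwards [hf.1, hg.1, eventually_log_natCast_pos] with N hfN hgN hlog
  rw [Real.strictMonoOn_log.monotoneOn.map_min hfN hgN, min_div_div_right hlog.le]

protected lemma max (hf : HasExponent f a) (hg : HasExponent g b) :
    HasExponent (fun N => max (f N) (g N)) (max a b) := by
  refine ⟨hf.1.mono fun N hfN => lt_max_of_lt_left hfN, (hf.2.max hg.2).congr' ?_⟩
  filter_upwards [hf.1, hg.1, eventually_log_natCast_pos] with N hfN hgN hlog
  rw [Real.strictMonoOn_log.monotoneOn.map_max hfN hgN, max_div_div_right hlog.le]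

lemma squeeze (hf : HasExponent f a) (hh : HasExponent h a) (hfg : ∀ᶠ N in atTop, f N ≤ g N)
    (hgh : ∀ᶠ N in atTop, g N ≤ h N) : HasExponent g a := by
  refine ⟨hf.1.mp (hfg.mono fun N hN hfN => hfN.trans_le hN),
    tendsto_of_tendsto_of_tendsto_of_le_of_le' hf.2 hh.2 ?_ ?_⟩
  · filter_upwards [hf.1, hfg, eventually_log_natCast_pos] with N hfN hN hlog
    gcongr
  · filter_upwards [hf.1, hfg, hgh, eventually_log_natCast_pos] with N hfN hfgN hghN hlog
    have := hfN.trans_le hfgN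
    gcongr

protected lemma add (hf : HasExponent f a) (hg : HasExponent g b) :
    HasExponent (fun N => f N + g N) (max a b) := by
  refine (hf.max hg).squeeze ((hf.max hg).const_mul two_pos) ?_
    (Eventually.of_forall fun N => ?_)
  · filter_upwards [hf.1, hg.1] with N hfN hgN
    exact max_le_add_of_nonneg hfN.le hgN.le
  · rw [two_mul]
    exact add_le_add (le_max_left _ _) (le_max_right _ _)

lemma add_const (hf : HasExponent f a) (ha : 0 ≤ a) {c : ℝ} (hc : 0 < c) :
    HasExponent (fun N => f N + c) a := by
  simpa only [max_eq_left ha] using hf.add (hasExponent_const hc)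

lemma eventually_lt (hf : HasExponent f a) (hg : HasExponent g b) (hab : a < b) :
    ∀ᶠ N in atTop, f N < g N := by
  filter_upwards [hf.1, hg.1, hf.2.eventually_lt hg.2 hab, eventually_log_natCast_pos]
    with N hfN hgN hlt hlog
  exact (Real.log_lt_log_iff hfN hgN).1 ((div_lt_div_iff_of_pos_right hlog).1 hlt)

lemma eventually_const_lt (hf : HasExponent f a) (ha : 0 < a) (c : ℝ) :
    ∀ᶠ N in atTop, c < f N :=
  ((hasExponent_const (c := |c| + 1) (by positivity)).eventually_lt hf ha).mono fun N hN => by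
    linarith [le_abs_self c]

protected lemma log (hf : HasExponent f a) (h2 : ∀ᶠ N in atTop, 2 ≤ f N) :
    HasExponent (fun N => Real.log (f N)) 0 := by
  refine (hasExponent_const (Real.log_pos one_lt_two)).squeeze
    (hasExponent_log_natCast.const_mul (c := |a| + 1) (by positivity)) ?_ ?_
  · exact h2.mono fun N hN => Real.log_le_log two_pos hN
  · have ha : a < |a| + 1 := by linarith [le_abs_self a]
    filter_upwards [hf.2.eventually_lt_const ha, eventually_log_natCast_pos] with N hN hlog
    exact ((div_lt_iff₀ hlog).1 hN).le

protected lemma floor (hf : HasExponent f a) (ha : 0 < a) :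
    HasExponent (fun N => (⌊f N⌋₊ : ℝ)) a := by
  have hlarge := hf.eventually_const_lt ha 1
  refine (hf.div_const two_pos).squeeze hf ?_ (hf.1.mono fun N hN => Nat.floor_le hN.le)
  filter_upwards [hlarge] with N hN
  have : (1 : ℝ) ≤ ⌊f N⌋₊ := Nat.one_le_cast.2 ((Nat.one_le_floor_iff _).2 hN.le)
  linarith [Nat.lt_floor_add_one (f N)]

end HasExponent

lemma HasScalingExponent.toReal {f : ℕ → ℝ≥0∞} {e : ℝ} (hf : HasScalingExponent f e) :
    HasExponent (fun N => (f N).toReal) e :=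
  ⟨hf.1.mono fun _ hN => ENNReal.toReal_pos hN.1 hN.2, hf.2⟩

lemma HasScalingExponent.natCast {B : ℕ → ℕ} {e : ℝ}
    (hB : HasScalingExponent (fun N => (B N : ℝ≥0∞)) e) : HasExponent (fun N => (B N : ℝ)) e := by
  simpa only [ENNReal.toReal_natCast] using hB.toReal

lemma HasExponent.hasScalingExponent {f : ℕ → ℝ≥0∞} {g h : ℕ → ℝ} {e : ℝ}
    (hg : HasExponent g e) (hh : HasExponent h e)
    (hgf : ∀ᶠ N in atTop, ENNReal.ofReal (g N) ≤ f N)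
    (hfh : ∀ᶠ N in atTop, f N ≤ ENNReal.ofReal (h N)) : HasScalingExponent f e := by
  have htop : ∀ᶠ N in atTop, f N ≠ ∞ :=
    hfh.mono fun N hN => ne_top_of_le_ne_top ENNReal.ofReal_ne_top hN
  have hreal : HasExponent (fun N => (f N).toReal) e := by
    refine hg.squeeze hh ?_ ?_
    · filter_upwards [htop, hgf] with N hN hle
      exact (ENNReal.ofReal_le_iff_le_toReal hN).1 hle
    · filter_upwards [hh.1, hfh] with N hN hle
      exact ENNReal.toReal_le_of_le_ofReal hN.le hle
  exact ⟨hreal.1.mono fun N hN => ENNReal.toReal_pos_iff.1 hN |>.imp ne_of_gt ne_of_lt, hreal.2⟩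

lemma HasScalingExponent.eventually_rpow_mul_le {f g : ℕ → ℝ≥0∞} {u : ℕ → ℝ} {a b δ : ℝ}
    (hf : HasScalingExponent f a) (hu : HasExponent u b)
    (hug : ∀ᶠ N in atTop, ENNReal.ofReal (u N) ≤ g N) (hδ : a + δ < b) :
    ∀ᶠ N : ℕ in atTop, (N : ℝ≥0∞) ^ δ * f N ≤ g N := by
  have hlt := ((hasExponent_rpow δ).mul hf.toReal).eventually_lt hu (by linarith)
  filter_upwards [hf.1, hug, hlt, eventually_gt_atTop 0] with N hfN hN hltN hN0
  refine le_trans ?_ ((ENNReal.ofReal_le_ofReal hltN.le).trans hN)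
  rw [ENNReal.ofReal_mul (by positivity), ENNReal.ofReal_toReal hfN.2,
    ← ENNReal.ofReal_rpow_of_pos (Nat.cast_pos.2 hN0), ENNReal.ofReal_natCast]

/-! ### Scaling of the capacities -/

section Scaling

variable {P Δf ε τ : ℝ} {B L : ℕ → ℕ}

lemma HasScalingExponent.eventually_pos (hB : HasScalingExponent (fun N => (B N : ℝ≥0∞)) ε) :
    ∀ᶠ N in atTop, 0 < B N :=
  hB.natCast.1.mono fun _ => Nat.cast_pos.1

lemma hasExponent_log_add_one (hε : 0 ≤ ε)
    (hB : HasScalingExponent (fun N => (B N : ℝ≥0∞)) ε) :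
    HasExponent (fun N => Real.log (B N + 1)) 0 := by
  refine (hB.natCast.add_const hε one_pos).log (hB.eventually_pos.mono fun N hN => ?_)
  have : (1 : ℝ) ≤ B N := Nat.one_le_cast.2 hN
  linarith

lemma hasExponent_log_mul (hL : HasScalingExponent (fun N => (L N : ℝ≥0∞)) τ) :
    HasExponent (fun N => Real.log (N * L N)) 0 := by
  refine (hasExponent_natCast.mul hL.natCast).log ?_
  filter_upwards [hL.eventually_pos, eventually_ge_atTop 2] with N hLN hN
  exact_mod_cast Nat.mul_le_mul hN hLN

lemma hasExponent_energyRateBound (hP : 0 < P) (hΔf : 0 < Δf) (hε : 0 ≤ ε) (hτ : 0 ≤ τ)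
    (hB : HasScalingExponent (fun N => (B N : ℝ≥0∞)) ε)
    (hL : HasScalingExponent (fun N => (L N : ℝ≥0∞)) τ) :
    HasExponent (fun N => energyRateBound P Δf (B N) N (L N)) (1 / 2) := by
  have hfactor := (hasExponent_log_add_one hε hB).add_const le_rfl (c := 3) (by norm_num)
  have hrate := ((((hasExponent_const one_pos).add ((hfactor.mul hasExponent_natCast.sqrt).mul
    (hL.natCast.const_mul hP))).div_const (Real.log_pos one_lt_two)).div
      (hL.natCast.div_const hΔf))
  refine hrate.congr_exponent ?_
  rw [max_eq_right (by linarith)]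
  ring

lemma hasExponent_bandwidthRateBound (hP : 0 < P) (hΔf : 0 < Δf) (hε : 0 ≤ ε)
    (hB : HasScalingExponent (fun N => (B N : ℝ≥0∞)) ε)
    (hL : HasScalingExponent (fun N => (L N : ℝ≥0∞)) τ) :
    HasExponent (fun N => bandwidthRateBound P Δf (B N) N (L N)) (ε - τ) := by
  have hfactor := ((hasExponent_log_add_one hε hB).add
    ((hasExponent_log_mul hL).const_mul two_pos)).add_const (by simp) two_pos
  rw [max_self] at hfactor
  have hrate := (((hB.natCast.mul hfactor).add_const (by simpa) (mul_pos two_pos hP)).div_const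
    (Real.log_pos one_lt_two)).div (hL.natCast.div_const hΔf)
  exact hrate.congr_exponent (by rw [add_zero])

/-- The probability with which on–off modulation may activate a subcarrier. -/
def onProbability (P : ℝ) (B N L : ℕ) : ℝ := min (1 / 2) (P * L / (B * onEnergy N))

lemma onProbability_nonneg (hP : 0 ≤ P) (B N L : ℕ) : 0 ≤ onProbability P B N L := by
  unfold onProbability onEnergy
  positivity

lemma onProbability_le_half (P : ℝ) (B N L : ℕ) : onProbability P B N L ≤ 1 / 2 :=
  min_le_left _ _

/-- The rate of on–off energy modulation. -/
def onOffRate (P Δf : ℝ) (B N L : ℕ) : ℝ :=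
  B * (onProbability P B N L * (1 - onProbability P B N L)) / 16 / Real.log 2 / (L / Δf)

lemma onOffRate_le_oedCapacity {B N L : ℕ} (hP : 0 < P) (hΔf : 0 < Δf) (hB : 0 < B) (hL : 0 < L)
    (hN : 16 * fourthMomentBound ≤ N) :
    ENNReal.ofReal (onOffRate P Δf B N L) ≤ oedCapacity P Δf B N L := by
  have hN' : (0 : ℝ) < N := by linarith [fourthMomentBound_pos]
  have henergy : 0 < B * onEnergy N :=
    mul_pos (Nat.cast_pos.2 hB) (onEnergy_pos (Nat.cast_pos.1 hN'))
  refine le_oedCapacity (p := ⟨onProbability P B N L, onProbability_nonneg hP.le B N L, ?_⟩)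
    hΔf hL hN ?_
  · linarith [onProbability_le_half P B N L]
  · rw [mul_left_comm, ← le_div_iff₀ henergy]
    exact min_le_right _ _

lemma hasExponent_onEnergy : HasExponent onEnergy (-1 / 2) :=
  (((hasExponent_const fourthMomentBound_pos).div hasExponent_natCast).sqrt.const_mul
    four_pos).congr_exponent (by norm_num)

lemma hasExponent_onOffRate (hP : 0 < P) (hΔf : 0 < Δf)
    (hB : HasScalingExponent (fun N => (B N : ℝ≥0∞)) ε)
    (hL : HasScalingExponent (fun N => (L N : ℝ≥0∞)) τ) :
    HasExponent (fun N => onOffRate P Δf (B N) N (L N)) (min (ε - τ) (1 / 2)) := by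
  have hon : HasExponent (fun N => onProbability P (B N) N (L N)) (min 0 (τ - (ε + -1 / 2))) :=
    (hasExponent_const one_half_pos).min
      ((hL.natCast.const_mul hP).div (hB.natCast.mul hasExponent_onEnergy))
  have hoff : HasExponent (fun N => 1 - onProbability P (B N) N (L N)) 0 := by
    refine (hasExponent_const one_half_pos).squeeze (hasExponent_const one_pos)
      (Eventually.of_forall fun N => ?_) (Eventually.of_forall fun N => ?_)
    · linarith [onProbability_le_half P (B N) N (L N)]
    · linarith [onProbability_nonneg hP.le (B N) N (L N)]
  have hrate := (((hB.natCast.mul (hon.mul hoff)).div_const (c := 16) (by norm_num)).div_const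
    (Real.log_pos one_lt_two)).div (hL.natCast.div_const hΔf)
  refine hrate.congr_exponent ?_
  rw [add_zero, ← min_add_add_left, ← min_sub_sub_right]
  ring_nf

lemma hasScalingExponent_oedCapacity (hP : 0 < P) (hΔf : 0 < Δf) (hε : 0 ≤ ε) (hτ : 0 ≤ τ)
    (hB : HasScalingExponent (fun N => (B N : ℝ≥0∞)) ε)
    (hL : HasScalingExponent (fun N => (L N : ℝ≥0∞)) τ) :
    HasScalingExponent (fun N => oedCapacity P Δf (B N) N (L N)) (min (ε - τ) (1 / 2)) := by
  refine (hasExponent_onOffRate hP hΔf hB hL).hasScalingExponent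
    ((hasExponent_bandwidthRateBound hP hΔf hε hB hL).min
      (hasExponent_energyRateBound hP hΔf hε hτ hB hL)) ?_ ?_
  · filter_upwards [hB.eventually_pos, hL.eventually_pos,
      tendsto_natCast_atTop_atTop.eventually_ge_atTop (16 * fourthMomentBound)] with N hBN hLN hN
    exact onOffRate_le_oedCapacity hP hΔf hBN hLN hN
  · filter_upwards [hB.eventually_pos, hL.eventually_pos, eventually_gt_atTop 0]
      with N hBN hLN hN
    rw [ENNReal.ofReal_min]
    exact le_min (oedCapacity_le_bandwidthRateBound hP.le hΔf hBN hN hLN)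
      (oedCapacity_le_energyRateBound hP.le hΔf hBN hN hLN)

/-- The energy of the pilot in pilot-aided signalling. The total energy `A + L * c / (N * A)` of a
block with pilot energy `A` is least at `A` of order `√(L / N)`; the cap at `1` keeps the fourth
moments of the received symbols bounded. -/
def pilotEnergy (N L : ℕ) : ℝ := min 1 √(L / N)

/-- The energy of a data symbol, the least that the pilot energy allows to be detected. -/
def dataEnergy (N L : ℕ) : ℝ := 4 * fourthMomentBound / (N * pilotEnergy N L)

/-- The number of subcarriers that pilot-aided signalling uses under the power constraint. -/
def pilotCount (P : ℝ) (B N L : ℕ) : ℕ :=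
  min B ⌊P * L / (pilotEnergy N L + L * dataEnergy N L)⌋₊

/-- The rate of pilot-aided signalling. -/
def pilotRate (P Δf : ℝ) (B N L : ℕ) : ℝ :=
  pilotCount P B N L * (L / 2) / 64 / Real.log 2 / (L / Δf)

lemma pilotEnergy_pos {N L : ℕ} (hN : 0 < N) (hL : 0 < L) : 0 < pilotEnergy N L :=
  lt_min one_pos (Real.sqrt_pos.2 (div_pos (Nat.cast_pos.2 hL) (Nat.cast_pos.2 hN)))

lemma dataEnergy_pos {N L : ℕ} (hN : 0 < N) (hL : 0 < L) : 0 < dataEnergy N L :=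
  div_pos (mul_pos four_pos fourthMomentBound_pos)
    (mul_pos (Nat.cast_pos.2 hN) (pilotEnergy_pos hN hL))

lemma pilotCount_mul_le {B N L : ℕ} (hP : 0 ≤ P) (hN : 0 < N) (hL : 0 < L) :
    pilotCount P B N L * (pilotEnergy N L + L * dataEnergy N L) ≤ P * L := by
  have := pilotEnergy_pos hN hL
  have := dataEnergy_pos hN hL
  rw [← le_div_iff₀ (by positivity)]
  exact (Nat.cast_le.2 (min_le_right _ _)).trans (Nat.floor_le (by positivity))

lemma pilotRate_le_nonCoherentCapacity {B N L : ℕ} (hP : 0 ≤ P) (hΔf : 0 < Δf) (hN : 0 < N)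
    (hL : 2 ≤ L) (hdata : dataEnergy N L ≤ 1) :
    ENNReal.ofReal (pilotRate P Δf B N L) ≤ nonCoherentCapacity P Δf B N L := by
  obtain ⟨l, rfl⟩ := Nat.exists_eq_add_one_of_ne_zero (by omega : L ≠ 0)
  have hl : (1 : ℝ) ≤ l := Nat.one_le_cast.2 (by omega)
  have hA := pilotEnergy_pos hN l.succ_pos
  have hr := dataEnergy_pos hN l.succ_pos
  have hN' : (0 : ℝ) < N := Nat.cast_pos.2 hN
  have hsnr : 4 * fourthMomentBound ≤ N * (pilotEnergy N (l + 1) * dataEnergy N (l + 1)) := by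
    rw [← mul_assoc, dataEnergy, mul_div_cancel₀ _ (mul_pos hN' hA).ne']
  have hpow : pilotCount P B N (l + 1) * (pilotEnergy N (l + 1) + l * dataEnergy N (l + 1)) ≤
      P * (l + 1 : ℕ) := by
    refine le_trans ?_ (pilotCount_mul_le (B := B) hP hN l.succ_pos)
    gcongr
    exact l.le_succ
  refine (ENNReal.ofReal_le_ofReal ?_).trans
    (le_nonCoherentCapacity (S := pilotCount P B N (l + 1)) hΔf (min_le_left _ _) hN hA
      (min_le_left _ _) hr hdata hsnr hpow)
  have hhalf : ((l + 1 : ℕ) : ℝ) / 2 ≤ l := by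
    push_cast
    linarith
  rw [pilotRate]
  gcongr

lemma hasExponent_pilotEnergy (hL : HasScalingExponent (fun N => (L N : ℝ≥0∞)) τ) :
    HasExponent (fun N => pilotEnergy N (L N)) (min 0 ((τ - 1) / 2)) :=
  (hasExponent_const one_pos).min (hL.natCast.div hasExponent_natCast).sqrt

lemma hasExponent_dataEnergy (hL : HasScalingExponent (fun N => (L N : ℝ≥0∞)) τ) :
    HasExponent (fun N => dataEnergy N (L N)) (-(1 + min 0 ((τ - 1) / 2))) :=
  ((hasExponent_const (mul_pos four_pos fourthMomentBound_pos)).div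
    (hasExponent_natCast.mul (hasExponent_pilotEnergy hL))).congr_exponent (zero_sub _)

lemma eventually_dataEnergy_le_one (hτ : 0 ≤ τ)
    (hL : HasScalingExponent (fun N => (L N : ℝ≥0∞)) τ) :
    ∀ᶠ N in atTop, dataEnergy N (L N) ≤ 1 := by
  have hneg : -(1 + min 0 ((τ - 1) / 2)) < 0 := by
    rcases min_cases 0 ((τ - 1) / 2) with h | h <;> linarith
  exact ((hasExponent_dataEnergy hL).eventually_lt (hasExponent_const one_pos) hneg).mono
    fun _ => le_of_lt

lemma hasExponent_pilotCount (hP : 0 < P) (hτ : 0 ≤ τ)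
    (hB : HasScalingExponent (fun N => (B N : ℝ≥0∞)) ε)
    (hL : HasScalingExponent (fun N => (L N : ℝ≥0∞)) τ) :
    HasExponent (fun N => (pilotCount P (B N) N (L N) : ℝ)) (min ε ((1 + min τ 1) / 2)) := by
  have hblock := (hL.natCast.const_mul hP).div
    ((hasExponent_pilotEnergy hL).add (hL.natCast.mul (hasExponent_dataEnergy hL)))
  have hexp : τ - max (min 0 ((τ - 1) / 2)) (τ + -(1 + min 0 ((τ - 1) / 2))) =
      (1 + min τ 1) / 2 := by
    grind
  have hpos : 0 < (1 + min τ 1) / 2 := by positivity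
  simpa only [pilotCount, Nat.cast_min] using
    hB.natCast.min ((hblock.congr_exponent hexp).floor hpos)

lemma hasExponent_pilotRate (hP : 0 < P) (hΔf : 0 < Δf) (hτ : 0 ≤ τ)
    (hB : HasScalingExponent (fun N => (B N : ℝ≥0∞)) ε)
    (hL : HasScalingExponent (fun N => (L N : ℝ≥0∞)) τ) :
    HasExponent (fun N => pilotRate P Δf (B N) N (L N)) (min ε ((1 + min τ 1) / 2)) := by
  have hrate := ((((hasExponent_pilotCount hP hτ hB hL).mul
    (hL.natCast.div_const two_pos)).div_const (c := 64) (by norm_num)).div_const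
      (Real.log_pos one_lt_two)).div (hL.natCast.div_const hΔf)
  exact hrate.congr_exponent (add_sub_cancel_right _ _)

lemma eventually_pilotRate_le_nonCoherentCapacity (hP : 0 ≤ P) (hΔf : 0 < Δf) (hτ : 0 < τ)
    (hL : HasScalingExponent (fun N => (L N : ℝ≥0∞)) τ) :
    ∀ᶠ N in atTop, ENNReal.ofReal (pilotRate P Δf (B N) N (L N)) ≤
      nonCoherentCapacity P Δf (B N) N (L N) := by
  filter_upwards [eventually_gt_atTop 0, hL.natCast.eventually_const_lt hτ 2,
    eventually_dataEnergy_le_one hτ.le hL] with N hN hLN hdata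
  exact pilotRate_le_nonCoherentCapacity hP hΔf hN (by exact_mod_cast hLN.le) hdata

end Scaling

end WidebandSIMO

end

open WidebandSIMO in
theorem theorem2 (P Δf : ℝ) (hP : 0 < P) (hΔf : 0 < Δf) (ε τ : ℝ) (hε : 0 ≤ ε) (hτ : 0 ≤ τ)
    (B L : ℕ → ℕ) (hB : HasScalingExponent (fun N => (B N : ℝ≥0∞)) ε)
    (hL : HasScalingExponent (fun N => (L N : ℝ≥0∞)) τ) :
    HasScalingExponent (fun N => oedCapacity P Δf (B N) N (L N)) (min (ε - τ) (1 / 2)) ∧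
    (0 < τ → ∃ δ : ℝ, 0 < δ ∧ ∀ᶠ N : ℕ in atTop,
      (N : ℝ≥0∞) ^ δ * oedCapacity P Δf (B N) N (L N)
        ≤ nonCoherentCapacity P Δf (B N) N (L N)) := by
  have hoed := hasScalingExponent_oedCapacity hP hΔf hε hτ hB hL
  refine ⟨hoed, fun hτ_pos => ?_⟩
  have hgap : min (ε - τ) (1 / 2) < min ε ((1 + min τ 1) / 2) :=
    lt_min ((min_le_left _ _).trans_lt (by linarith))
      ((min_le_right _ _).trans_lt (by linarith [lt_min hτ_pos one_pos]))
  obtain ⟨δ, hδ_gap, hδ⟩ := exists_add_lt_and_pos_of_lt hgap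
  exact ⟨δ, hδ, hoed.eventually_rpow_mul_le (hasExponent_pilotRate hP hΔf hτ hB hL)
    (eventually_pilotRate_le_nonCoherentCapacity hP.le hΔf hτ_pos hL) hδ_gap⟩
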